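/- All vector spaces are complex and finite-dimensional. Let $\mathfrak g=\mathfrak g_{\bar 0}\oplus\mathfrak g_{\bar 1}$ be a $\mathbb Z_2$-graded vector space with a non-degenerate even supersymmetric bilinear form $B$, i.e. $B(\mathfrak g_{\bar0},\mathfrak g_{\bar1})=0$ and $B(X,Y)=(-1)^{xy}B(Y,X)$ for $X\in\mathfrak g_x$, $Y\in\mathfrak g_y$. Notation. Let $\mathrm{Alt}(\mathfrak g_{\bar0})$ be the exterior algebra of $\mathfrak g_{\bar0}^*$ and $\mathrm{Sym}(\mathfrak g_{\bar1})$ the symmetric algebra of $\mathfrak g_{\bar1}^*$. The super-exterior algebra is $\mathscr E(\mathfrak g)=\mathrm{Alt}(\mathfrak g_{\bar0})\otimes\mathrm{Sym}(\mathfrak g_{\bar1})$ with product $$(\Omega\otimes F)\wedge(\Omega'\otimes F')=(-1)^{f\omega'}(\Omega\wedge\Omega')\otimes FF'\qquad(F\in\mathrm{Sym}^f,\ \Omega'\in\mathrm{Alt}^{\omega'});$$ $\mathscr E^{(n,b)}(\mathfrak g)$ is the sum of the $\mathrm{Alt}^{\omega}\otimes\mathrm{Sym}^{f}$ with $\omega+f=n$,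 $f\equiv b$ mod $2$, and $\mathscr E^n(\mathfrak g)=\mathscr E^{(n,\bar0)}(\mathfrak g)\oplus\mathscr E^{(n,\bar1)}(\mathfrak g)$. For $X\in\mathfrak g_x$ let $\iota_X$ be the super-derivation of $\mathscr E(\mathfrak g)$ of degree $(-1,x)$, i.e. $\iota_X(A\wedge A')=\iota_X(A)\wedge A'+(-1)^{a+xb}A\wedge\iota_X(A')$ for $A\in\mathscr E^{(a,b)}(\mathfrak g)$, with $\iota_X(\alpha)=(-1)^{xy}\alpha(X)$ for $\alpha\in\mathfrak g_y^*$. Elements of $\mathscr E^n(\mathfrak g)$ are identified with super-antisymmetric $n$-linear forms on $\mathfrak g$ by $A(X,X_2,\dots,X_n)=(-1)^{xb}\,\iota_X(A)(X_2,\dots,X_n)$ for $A\in\mathscr E^{(n,b)}(\mathfrak g)$, $X\in\mathfrak g_x$. Let $\{Z_j\}$ be an orthonormal basis of $\mathfrak g_{\bar0}$ and $\{X_i,Y_i\}$ a Darboux basis of $\mathfrak g_{\bar1}$ ($B(X_i,X_j)=B(Y_i,Y_j)=0$, $B(X_i,Y_j)=\delta_{ij}$) with dual basis $\{p_i,q_i\}$;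 such bases exist, and the statements below hold for any choice of them. Put $\{\Omega,\Omega'\}=(-1)^{\omega+1}\sum_j\iota_{Z_j}(\Omega)\wedge\iota_{Z_j}(\Omega')$ for $\Omega\in\mathrm{Alt}^\omega(\mathfrak g_{\bar0})$, $\{F,F'\}=\sum_i\left(\frac{\partial F}{\partial p_i}\frac{\partial F'}{\partial q_i}-\frac{\partial F}{\partial q_i}\frac{\partial F'}{\partial p_i}\right)$ on $\mathrm{Sym}(\mathfrak g_{\bar1})$, and define on $\mathscr E(\mathfrak g)$ the super $\mathbb Z\times\mathbb Z_2$-Poisson bracket $$\{\Omega\otimes F,\Omega'\otimes F'\}=(-1)^{f\omega'}\big(\{\Omega,\Omega'\}\otimes FF'+(\Omega\wedge\Omega')\otimes\{F,F'\}\big),\qquad \mathrm{ad}_P(A)=\{A,\cdot\}.$$ For $t=\sum_i\Omega_i\otimes X_i\in\mathscr E^2(\mathfrak g)\otimes\mathfrak g$ with $\Omega_i$ of parity $\omega_i$ and $X_i\in\mathfrak g_{x_i}$, representing the bilinear map $F(Y,Z)=\sum_i\Omega_i(Y,Z)X_i$, put $D_F=-\sum_i(-1)^{x_i\omega_i}\,\Omega_i\wedge\iota_{X_i}\in\mathrm{End}(\mathscr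 E(\mathfrak g))$. If $F$ is a Lie superalgebra bracket, $d=D_F$ is called the super-exterior differential of $(\mathfrak g,F)$. (A) Let $[\cdot,\cdot]$ be a Lie superalgebra structure on $\mathfrak g$ for which $B$ is invariant: $B([X,Y],Z)=B(X,[Y,Z])$ for all $X,Y,Z$. Then the trilinear form $I(X,Y,Z)=B([X,Y],Z)$ belongs to $\mathscr E^{(3,\bar0)}(\mathfrak g)=\mathrm{Alt}^3(\mathfrak g_{\bar0})\oplus\big(\mathrm{Alt}^1(\mathfrak g_{\bar0})\otimes\mathrm{Sym}^2(\mathfrak g_{\bar1})\big)$ (i.e. it is the form of an element of this space, unique in $\mathscr E^3(\mathfrak g)$); the super-exterior differential of $(\mathfrak g,[\cdot,\cdot])$ is $d=-\mathrm{ad}_P(I)$; and $\{I,I\}=0$. (B) Let $I\in\mathscr E^{(3,\bar0)}(\mathfrak g)$. There is exactly one bilinear map $F:\mathfrak g\times\mathfrak g\to\mathfrak g$ with $D_F=-\mathrm{ad}_P(I)$, and it is even and super-antisymmetric. $F$ is a Lie superalgebra structure if and only if $\{I,I\}=0$. In this case, writing $[X,Y]=F(X,Y)$, one has $I(X,Y,Z)=B([X,Y],Z)$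 for all $X,Y,Z\in\mathfrak g$, and $B$ is invariant. (C) Consequently, mapping a structure to its form $I$ is a bijection from the set of Lie superalgebra structures on $\mathfrak g$ for which $B$ is invariant onto the set of $I\in\mathscr E^{(3,\bar0)}(\mathfrak g)$ with $\{I,I\}=0$, and under it the super-exterior differential of a structure is $-\mathrm{ad}_P(I)$. -/

import Mathlib

open scoped TensorProduct DirectSum

noncomputable section

namespace QuadSuper

/-! A `ℤ/2`-graded vector space `g = g₀ ⊕ g₁` is given by its even part `V₀` and its odd part `V₁`;
the total space is `V₀ × V₁`. -/

section Algebras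

variable (V₀ V₁ : Type*) [AddCommGroup V₀] [Module ℂ V₀] [AddCommGroup V₁] [Module ℂ V₁]

/-- `Alt(g₀)`, the exterior algebra of `g₀*`. -/
abbrev Alt : Type _ := ExteriorAlgebra ℂ (Module.Dual ℂ V₀)

/-- `Sym(g₁)`, the symmetric algebra of `g₁*`. -/
abbrev Sym : Type _ := SymmetricAlgebra ℂ (Module.Dual ℂ V₁)

/-- `Alt^i(g₀)`. -/
abbrev altPow (i : ℕ) : Submodule ℂ (Alt V₀) := ⋀[ℂ]^i (Module.Dual ℂ V₀)

/-- `Sym^i(g₁)`, spanned by the products of `i` linear forms. -/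
def symPow (i : ℕ) : Submodule ℂ (Sym V₁) :=
  LinearMap.range (SymmetricAlgebra.ι ℂ (Module.Dual ℂ V₁)) ^ i

instance : SetLike.GradedMonoid (symPow V₁) :=
  Submodule.nat_power_gradedMonoid (LinearMap.range (SymmetricAlgebra.ι ℂ (Module.Dual ℂ V₁)))

theorem ι_mem_symPow (p : Module.Dual ℂ V₁) :
    SymmetricAlgebra.ι ℂ (Module.Dual ℂ V₁) p ∈ symPow V₁ 1 := by
  simpa only [symPow, pow_one] using LinearMap.mem_range_self _ p

/-- Auxiliary map: `Sym(g₁) → ⨁ i, Sym^i(g₁)`. -/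
def symToGraded : Sym V₁ →ₐ[ℂ] ⨁ i : ℕ, symPow V₁ i :=
  SymmetricAlgebra.lift
    (DirectSum.lof ℂ ℕ (fun i => symPow V₁ i) 1 ∘ₗ
      (SymmetricAlgebra.ι ℂ (Module.Dual ℂ V₁)).codRestrict _ (ι_mem_symPow V₁))

theorem symToGraded_eq (i : ℕ) (x : symPow V₁ i) :
    symToGraded V₁ x = DirectSum.of (fun i => symPow V₁ i) i x := by
  obtain ⟨x, hx⟩ := x
  dsimp only [Subtype.coe_mk]
  unfold symPow at hx
  induction hx using Submodule.pow_induction_on_left' with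
  | algebraMap => simp_rw [AlgHom.commutes, DirectSum.algebraMap_apply]; rfl
  | add _ _ _ _ _ ihx ihy => simp_rw [map_add, ihx, ihy, ← map_add]; rfl
  | mem_mul _ hm _ _ _ ih =>
      obtain ⟨p, rfl⟩ := hm
      have h1 : symToGraded V₁ (SymmetricAlgebra.ι ℂ (Module.Dual ℂ V₁) p) =
          DirectSum.of (fun i => symPow V₁ i) 1 ⟨_, ι_mem_symPow V₁ p⟩ := by
        rw [symToGraded, SymmetricAlgebra.lift_ι_apply]; rfl
      rw [map_mul, ih, h1, DirectSum.of_mul_of]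
      exact DirectSum.of_eq_of_gradedMonoid_eq (Sigma.subtype_ext (add_comm _ _) rfl)

instance symGraded : GradedAlgebra (symPow V₁) :=
  GradedAlgebra.ofAlgHom _ (symToGraded V₁)
    (by
      ext p
      change DirectSum.coeAlgHom (symPow V₁)
        (symToGraded V₁ (SymmetricAlgebra.ι ℂ (Module.Dual ℂ V₁) p)) = _
      rw [symToGraded, SymmetricAlgebra.lift_ι_apply, LinearMap.comp_apply, DirectSum.lof_eq_of,
        DirectSum.coeAlgHom_of]
      rfl)
    (symToGraded_eq V₁)

/-- The super-exterior algebra `E(g) = Alt(g₀) ⊗ Sym(g₁)`. Its multiplication `*` is the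
super-exterior product
`(Ω ⊗ F) ∧ (Ω' ⊗ F') = (-1)^{f ω'} (Ω ∧ Ω') ⊗ F F'` for `F ∈ Sym^f`, `Ω' ∈ Alt^{ω'}`. -/
abbrev SuperExt : Type _ := GradedTensorProduct ℂ (fun i : ℕ => altPow V₀ i) (symPow V₁)

/-- The identification of the super-exterior algebra, as a vector space, with the tensor product. -/
def ofTensor : Alt V₀ ⊗[ℂ] Sym V₁ ≃ₗ[ℂ] SuperExt V₀ V₁ :=
  GradedTensorProduct.of ℂ (fun i : ℕ => altPow V₀ i) (symPow V₁)

/-- `Alt^ω(g₀) ⊗ Sym^f(g₁)` inside `E(g)`. -/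
def tensorPart (ω f : ℕ) : Submodule ℂ (SuperExt V₀ V₁) :=
  Submodule.span ℂ {A | ∃ Ω ∈ altPow V₀ ω, ∃ F ∈ symPow V₁ f, A = ofTensor V₀ V₁ (Ω ⊗ₜ[ℂ] F)}

/-- `E^{(n,b)}(g)`, the sum of the `Alt^ω ⊗ Sym^f` with `ω + f = n` and `f ≡ b mod 2`. -/
def bidegree (n : ℕ) (b : ZMod 2) : Submodule ℂ (SuperExt V₀ V₁) :=
  ⨆ (ω : ℕ) (f : ℕ) (_ : ω + f = n ∧ (f : ZMod 2) = b), tensorPart V₀ V₁ ω f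

/-- `E^n(g)`, the sum of the `Alt^ω ⊗ Sym^f` with `ω + f = n`. -/
def degree (n : ℕ) : Submodule ℂ (SuperExt V₀ V₁) :=
  ⨆ (ω : ℕ) (f : ℕ) (_ : ω + f = n), tensorPart V₀ V₁ ω f

/-- The linear map of `E(g)` with `Ω ⊗ F ↦ u Ω ⊗ v F`. -/
def mapTensor (u : Alt V₀ →ₗ[ℂ] Alt V₀) (v : Sym V₁ →ₗ[ℂ] Sym V₁) :
    SuperExt V₀ V₁ →ₗ[ℂ] SuperExt V₀ V₁ :=
  (ofTensor V₀ V₁).toLinearMap ∘ₗ TensorProduct.map u v ∘ₗ (ofTensor V₀ V₁).symm.toLinearMap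

/-- `Ω ↦ (-1)^ω Ω` for `Ω ∈ Alt^ω(g₀)`. -/
def altSign : Alt V₀ →ₗ[ℂ] Alt V₀ :=
  (CliffordAlgebra.involute : Alt V₀ →ₐ[ℂ] Alt V₀).toLinearMap

/-- `F ↦ (-1)^f F` for `F ∈ Sym^f(g₁)`. -/
def symSign : Sym V₁ →ₗ[ℂ] Sym V₁ :=
  (SymmetricAlgebra.lift (-(SymmetricAlgebra.ι ℂ (Module.Dual ℂ V₁))) :
    Sym V₁ →ₐ[ℂ] Sym V₁).toLinearMap

/-- `A ↦ (-1)^b A` for `A ∈ E^{(a,b)}(g)`. -/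
def paritySign : SuperExt V₀ V₁ →ₗ[ℂ] SuperExt V₀ V₁ :=
  mapTensor V₀ V₁ LinearMap.id (symSign V₁)

/-- The braiding `F ⊗ Ω ↦ (-1)^{f ω} Ω ⊗ F` for `F ∈ Sym^f(g₁)`, `Ω ∈ Alt^ω(g₀)`. -/
def braid : Sym V₁ ⊗[ℂ] Alt V₀ →ₗ[ℂ] Alt V₀ ⊗[ℂ] Sym V₁ :=
  (TensorProduct.congr (DirectSum.decomposeLinearEquiv (fun i : ℕ => altPow V₀ i))
      (DirectSum.decomposeLinearEquiv (symPow V₁))).symm.toLinearMap ∘ₗ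
    (TensorProduct.gradedComm ℂ (fun i => symPow V₁ i) (fun i : ℕ => altPow V₀ i)).toLinearMap ∘ₗ
    (TensorProduct.congr (DirectSum.decomposeLinearEquiv (symPow V₁))
      (DirectSum.decomposeLinearEquiv (fun i : ℕ => altPow V₀ i))).toLinearMap

theorem braid_tmul {f ω : ℕ} {F : Sym V₁} (hF : F ∈ symPow V₁ f) {Ω : Alt V₀}
    (hΩ : Ω ∈ altPow V₀ ω) :
    braid V₀ V₁ (F ⊗ₜ[ℂ] Ω) = (-1 : ℂ) ^ (f * ω) • (Ω ⊗ₜ[ℂ] F) := by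
  lift F to symPow V₁ f using hF
  lift Ω to altPow V₀ ω using hΩ
  simp only [braid, LinearMap.comp_apply, LinearEquiv.coe_coe, TensorProduct.congr_tmul,
    DirectSum.decomposeLinearEquiv_apply, DirectSum.decompose_coe]
  rw [← DirectSum.lof_eq_of ℂ, ← DirectSum.lof_eq_of ℂ, TensorProduct.gradedComm_of_tmul_of,
    Units.smul_def, ← Int.cast_smul_eq_zsmul ℂ, LinearEquiv.map_smul,
    TensorProduct.congr_symm_tmul]
  congr 1
  · rw [mul_comm]; push_cast [uzpow_natCast]; simp
  · rw [DirectSum.lof_eq_of, DirectSum.lof_eq_of]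
    congr 1 <;> exact DirectSum.decompose_symm_of _ _

/-- For bilinear operations `m` on `Alt(g₀)` and `m'` on `Sym(g₁)`, the bilinear operation
`(Ω ⊗ F, Ω' ⊗ F') ↦ (-1)^{f ω'} m(Ω, Ω') ⊗ m'(F, F')` on `E(g)`. -/
def twisted (m : Alt V₀ →ₗ[ℂ] Alt V₀ →ₗ[ℂ] Alt V₀) (m' : Sym V₁ →ₗ[ℂ] Sym V₁ →ₗ[ℂ] Sym V₁) :
    SuperExt V₀ V₁ →ₗ[ℂ] SuperExt V₀ V₁ →ₗ[ℂ] SuperExt V₀ V₁ :=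
  ((TensorProduct.curry
    (TensorProduct.map (TensorProduct.lift m) (TensorProduct.lift m') ∘ₗ
      (TensorProduct.assoc ℂ (Alt V₀) (Alt V₀) (Sym V₁ ⊗[ℂ] Sym V₁)).symm.toLinearMap ∘ₗ
      LinearMap.lTensor (Alt V₀)
        ((TensorProduct.assoc ℂ (Alt V₀) (Sym V₁) (Sym V₁)).toLinearMap ∘ₗ
          LinearMap.rTensor (Sym V₁) (braid V₀ V₁) ∘ₗ
          (TensorProduct.assoc ℂ (Sym V₁) (Alt V₀) (Sym V₁)).symm.toLinearMap) ∘ₗ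
      (TensorProduct.assoc ℂ (Alt V₀) (Sym V₁) (Alt V₀ ⊗[ℂ] Sym V₁)).toLinearMap)).compl₁₂
    (ofTensor V₀ V₁).symm.toLinearMap (ofTensor V₀ V₁).symm.toLinearMap).compr₂
    (ofTensor V₀ V₁).toLinearMap

theorem twisted_tmul (m : Alt V₀ →ₗ[ℂ] Alt V₀ →ₗ[ℂ] Alt V₀)
    (m' : Sym V₁ →ₗ[ℂ] Sym V₁ →ₗ[ℂ] Sym V₁) {f ω' : ℕ} (Ω : Alt V₀) {F : Sym V₁}
    (hF : F ∈ symPow V₁ f) {Ω' : Alt V₀} (hΩ' : Ω' ∈ altPow V₀ ω') (F' : Sym V₁) :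
    twisted V₀ V₁ m m' (ofTensor V₀ V₁ (Ω ⊗ₜ[ℂ] F)) (ofTensor V₀ V₁ (Ω' ⊗ₜ[ℂ] F')) =
      (-1 : ℂ) ^ (f * ω') • ofTensor V₀ V₁ (m Ω Ω' ⊗ₜ[ℂ] m' F F') := by
  simp only [twisted, LinearMap.compr₂_apply, LinearMap.compl₁₂_apply, LinearEquiv.coe_coe,
    LinearEquiv.symm_apply_apply, TensorProduct.curry_apply, LinearMap.comp_apply,
    TensorProduct.assoc_tmul, LinearMap.lTensor_tmul, TensorProduct.assoc_symm_tmul,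
    LinearMap.rTensor_tmul, braid_tmul V₀ V₁ hF hΩ', ← TensorProduct.smul_tmul', map_smul,
    TensorProduct.tmul_smul, TensorProduct.map_tmul, TensorProduct.lift.tmul]

end Algebras

section Interior

variable {V₀ V₁ : Type*} [AddCommGroup V₀] [Module ℂ V₀] [AddCommGroup V₁] [Module ℂ V₁]

/-- The interior product `ι_X` on `Alt(g₀)`: the super-derivation of degree `-1` with
`ι_X(α) = α(X)` for `α ∈ g₀*`. -/
def altInterior (X : V₀) : Alt V₀ →ₗ[ℂ] Alt V₀ :=
  CliffordAlgebra.contractLeft (Module.Dual.eval ℂ V₀ X)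

/-- Auxiliary map `F ↦ F + ε ∂_X F`. -/
def symDerivAux (X : V₁) : Sym V₁ →ₐ[ℂ] TrivSqZeroExt (Sym V₁) (Sym V₁) :=
  SymmetricAlgebra.lift
    ((TrivSqZeroExt.inlAlgHom ℂ (Sym V₁) (Sym V₁)).toLinearMap ∘ₗ
        SymmetricAlgebra.ι ℂ (Module.Dual ℂ V₁) +
      (TrivSqZeroExt.inrHom (Sym V₁) (Sym V₁)).restrictScalars ℂ ∘ₗ
        Algebra.linearMap ℂ (Sym V₁) ∘ₗ Module.Dual.eval ℂ V₁ X)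

theorem fst_symDerivAux (X : V₁) (F : Sym V₁) : (symDerivAux X F).fst = F := by
  have h : (TrivSqZeroExt.fstHom ℂ (Sym V₁) (Sym V₁)).comp (symDerivAux X) =
      AlgHom.id ℂ (Sym V₁) := by
    ext p
    simp [symDerivAux]
  exact congrArg (fun φ : Sym V₁ →ₐ[ℂ] Sym V₁ => φ F) h

/-- The partial derivative `∂_X` on the polynomial algebra `Sym(g₁)`: the derivation with
`∂_X p = p(X)` for `p ∈ g₁*`. -/
def symDeriv (X : V₁) : Derivation ℂ (Sym V₁) (Sym V₁) :=
  Derivation.mk'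
    ((TrivSqZeroExt.sndHom (Sym V₁) (Sym V₁)).restrictScalars ℂ ∘ₗ (symDerivAux X).toLinearMap)
    (fun F G => by
      simp [fst_symDerivAux, mul_comm])

theorem symDeriv_ι (X : V₁) (p : Module.Dual ℂ V₁) :
    symDeriv X (SymmetricAlgebra.ι ℂ _ p) = algebraMap ℂ (Sym V₁) (p X) := by
  simp [symDeriv, symDerivAux, Algebra.algebraMap_eq_smul_one]

theorem symDeriv_add_smul (c : ℂ) (X Y : V₁) (F : Sym V₁) :
    symDeriv (c • X + Y) F = c • symDeriv X F + symDeriv Y F := by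
  induction F using SymmetricAlgebra.induction with
  | algebraMap r => simp
  | ι p => simp [symDeriv_ι, Algebra.smul_def]
  | mul F G hF hG => simp only [Derivation.leibniz, hF, hG, smul_eq_mul, mul_add,
      mul_smul_comm, smul_add]; abel
  | add F G hF hG => simp only [map_add, hF, hG, smul_add]; abel

variable (V₀ V₁) in
/-- The component in `E^0(g) = ℂ`. -/
def scalarPart : SuperExt V₀ V₁ →ₗ[ℂ] ℂ :=
  TensorProduct.lift ((LinearMap.mul ℂ ℂ).compl₁₂
    (ExteriorAlgebra.algebraMapInv (R := ℂ) (M := Module.Dual ℂ V₀)).toLinearMap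
    (SymmetricAlgebra.algebraMapInv (R := ℂ) (M := Module.Dual ℂ V₁)).toLinearMap) ∘ₗ
    (ofTensor V₀ V₁).symm.toLinearMap

/-- The interior product `ι_X` on `E(g)` by an even `X`: `ι_X(Ω ⊗ F) = ι_X(Ω) ⊗ F`. -/
def evenInterior (X : V₀) : SuperExt V₀ V₁ →ₗ[ℂ] SuperExt V₀ V₁ :=
  mapTensor V₀ V₁ (altInterior X) LinearMap.id

/-- The interior product `ι_X` on `E(g)` by an odd `X`: `ι_X(Ω ⊗ F) = (-1)^ω Ω ⊗ ι_X(F)`, where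
`ι_X(F) = -∂_X F`. It is the super-derivation of degree `(-1, 1)` with `ι_X(α) = 0` for `α ∈ g₀*`
and `ι_X(p) = -p(X)` for `p ∈ g₁*`. -/
def oddInterior (X : V₁) : SuperExt V₀ V₁ →ₗ[ℂ] SuperExt V₀ V₁ :=
  mapTensor V₀ V₁ (altSign V₀) (-(symDeriv X).toLinearMap)

theorem mapTensor_add_smul_left (c : ℂ) (u u' : Alt V₀ →ₗ[ℂ] Alt V₀)
    (v : Sym V₁ →ₗ[ℂ] Sym V₁) (A : SuperExt V₀ V₁) :
    mapTensor V₀ V₁ (c • u + u') v A = c • mapTensor V₀ V₁ u v A + mapTensor V₀ V₁ u' v A := by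
  simp [mapTensor, TensorProduct.map_add_left, TensorProduct.map_smul_left]

theorem mapTensor_add_smul_right (c : ℂ) (u : Alt V₀ →ₗ[ℂ] Alt V₀)
    (v v' : Sym V₁ →ₗ[ℂ] Sym V₁) (A : SuperExt V₀ V₁) :
    mapTensor V₀ V₁ u (c • v + v') A = c • mapTensor V₀ V₁ u v A + mapTensor V₀ V₁ u v' A := by
  simp [mapTensor, TensorProduct.map_add_right, TensorProduct.map_smul_right]

theorem evenInterior_add_smul (c : ℂ) (X Y : V₀) (A : SuperExt V₀ V₁) :
    evenInterior (c • X + Y) A = c • evenInterior X A + evenInterior Y A := by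
  rw [evenInterior, evenInterior, evenInterior, ← mapTensor_add_smul_left]
  simp [altInterior]

theorem oddInterior_add_smul (c : ℂ) (X Y : V₁) (A : SuperExt V₀ V₁) :
    oddInterior (c • X + Y) A = c • oddInterior X A + oddInterior Y A := by
  rw [oddInterior, oddInterior, oddInterior, ← mapTensor_add_smul_right]
  congr 2
  refine LinearMap.ext fun F => ?_
  change -(symDeriv (c • X + Y) F) = c • -(symDeriv X F) + -(symDeriv Y F)
  rw [symDeriv_add_smul, smul_neg, neg_add]

theorem evenInterior_add (X Y : V₀) (A : SuperExt V₀ V₁) :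
    evenInterior (X + Y) A = evenInterior X A + evenInterior Y A := by
  simpa using evenInterior_add_smul 1 X Y A

theorem oddInterior_add (X Y : V₁) (A : SuperExt V₀ V₁) :
    oddInterior (X + Y) A = oddInterior X A + oddInterior Y A := by
  simpa using oddInterior_add_smul 1 X Y A

theorem evenInterior_smul (c : ℂ) (X : V₀) (A : SuperExt V₀ V₁) :
    evenInterior (c • X) A = c • evenInterior X A := by
  have h0 : evenInterior (0 : V₀) A = 0 := by simpa using evenInterior_add_smul 1 (0 : V₀) 0 A
  simpa [h0] using evenInterior_add_smul c X 0 A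

theorem oddInterior_smul (c : ℂ) (X : V₁) (A : SuperExt V₀ V₁) :
    oddInterior (c • X) A = c • oddInterior X A := by
  have h0 : oddInterior (0 : V₁) A = 0 := by simpa using oddInterior_add_smul 1 (0 : V₁) 0 A
  simpa [h0] using oddInterior_add_smul c X 0 A

/-- An element of `E(g)` as a super-antisymmetric multilinear form on `g`: `eval n v A` is the value
`A(v₀, …, vₙ₋₁)` of (the component in `E^n(g)` of) `A`. The interior product of a form `A` of parity
`b` by `X` of parity `x` is `ι_X(A)(X₂, …) = (-1)^{x b} A(X, X₂, …)`; this relation, extended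
linearly to all `X` and `A`, determines the values. -/
def eval : (n : ℕ) → (Fin n → V₀ × V₁) → SuperExt V₀ V₁ →ₗ[ℂ] ℂ
  | 0, _ => scalarPart V₀ V₁
  | n + 1, v =>
      eval n (Fin.tail v) ∘ₗ
        (evenInterior (v 0).1 + oddInterior (v 0).2 ∘ₗ paritySign V₀ V₁)

end Interior

section Forms

variable {V₀ V₁ : Type*} [AddCommGroup V₀] [Module ℂ V₀] [AddCommGroup V₁] [Module ℂ V₁]

variable (V₀ V₁) in
/-- The homogeneous parts `g₀` and `g₁` of `g`. -/
def part (x : ZMod 2) : Submodule ℂ (V₀ × V₁) :=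
  if x = 0 then LinearMap.range (LinearMap.inl ℂ V₀ V₁) else LinearMap.range (LinearMap.inr ℂ V₀ V₁)

/-- The sign `(-1)^{xy}`. -/
def sgn (x y : ZMod 2) : ℂ := (-1) ^ (x.val * y.val)

/-- A quadratic `ℤ/2`-graded vector space: `B` is even, supersymmetric and non-degenerate. -/
structure IsQuadraticSpace (B : LinearMap.BilinForm ℂ (V₀ × V₁)) : Prop where
  even : ∀ X ∈ part V₀ V₁ 0, ∀ Y ∈ part V₀ V₁ 1, B X Y = 0
  supersymm : ∀ x y : ZMod 2, ∀ X ∈ part V₀ V₁ x, ∀ Y ∈ part V₀ V₁ y, B X Y = sgn x y * B Y X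
  nondegenerate : B.Nondegenerate

/-- An even super-antisymmetric bilinear map `g × g → g`. -/
structure IsEvenSuperAntisymm (F : V₀ × V₁ →ₗ[ℂ] V₀ × V₁ →ₗ[ℂ] V₀ × V₁) : Prop where
  even : ∀ x y : ZMod 2, ∀ X ∈ part V₀ V₁ x, ∀ Y ∈ part V₀ V₁ y, F X Y ∈ part V₀ V₁ (x + y)
  antisymm : ∀ x y : ZMod 2, ∀ X ∈ part V₀ V₁ x, ∀ Y ∈ part V₀ V₁ y, F X Y = -sgn x y • F Y X

/-- `[X, Y] = F(X, Y)` is a Lie superalgebra structure on `g`. -/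
structure IsLieSuper (F : V₀ × V₁ →ₗ[ℂ] V₀ × V₁ →ₗ[ℂ] V₀ × V₁) : Prop
    extends IsEvenSuperAntisymm F where
  jacobi : ∀ x y : ZMod 2, ∀ X ∈ part V₀ V₁ x, ∀ Y ∈ part V₀ V₁ y, ∀ Z,
    F X (F Y Z) = F (F X Y) Z + sgn x y • F Y (F X Z)

/-- `B` is invariant: `B([X, Y], Z) = B(X, [Y, Z])`. -/
def IsInvariant (B : LinearMap.BilinForm ℂ (V₀ × V₁))
    (F : V₀ × V₁ →ₗ[ℂ] V₀ × V₁ →ₗ[ℂ] V₀ × V₁) : Prop :=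
  ∀ X Y Z, B (F X Y) Z = B X (F Y Z)

/-- A quadratic Lie superalgebra structure on `(g, B)`. -/
def IsQuadraticLieSuper (B : LinearMap.BilinForm ℂ (V₀ × V₁))
    (F : V₀ × V₁ →ₗ[ℂ] V₀ × V₁ →ₗ[ℂ] V₀ × V₁) : Prop :=
  IsLieSuper F ∧ IsInvariant B F

/-- `I(X, Y, Z) = B([X, Y], Z)` for all `X, Y, Z`. -/
def IsAssociated (B : LinearMap.BilinForm ℂ (V₀ × V₁))
    (F : V₀ × V₁ →ₗ[ℂ] V₀ × V₁ →ₗ[ℂ] V₀ × V₁) (I : SuperExt V₀ V₁) : Prop :=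
  ∀ X Y Z, eval 3 ![X, Y, Z] I = B (F X Y) Z

/-- An orthonormal basis `Z₁, …, Zₘ` of `g₀` together with a Darboux basis
`X₁, …, Xₙ, Y₁, …, Yₙ` of `g₁`. -/
structure AdaptedBasis (B : LinearMap.BilinForm ℂ (V₀ × V₁)) where
  m : ℕ
  n : ℕ
  even : Module.Basis (Fin m) ℂ V₀
  odd : Module.Basis (Fin n ⊕ Fin n) ℂ V₁
  orthonormal : ∀ i j, B (even i, 0) (even j, 0) = if i = j then 1 else 0
  darboux_inl : ∀ i j, B (0, odd (.inl i)) (0, odd (.inl j)) = 0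
  darboux_inr : ∀ i j, B (0, odd (.inr i)) (0, odd (.inr j)) = 0
  darboux : ∀ i j, B (0, odd (.inl i)) (0, odd (.inr j)) = if i = j then 1 else 0

variable {B : LinearMap.BilinForm ℂ (V₀ × V₁)}

/-- The super Poisson bracket of `Alt(g₀)`:
`{Ω, Ω'} = (-1)^{k+1} ∑ⱼ ι_{Zⱼ}(Ω) ∧ ι_{Zⱼ}(Ω')` for `Ω ∈ Alt^k(g₀)`. -/
def altPoisson (b : AdaptedBasis B) : Alt V₀ →ₗ[ℂ] Alt V₀ →ₗ[ℂ] Alt V₀ :=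
  -∑ j, (LinearMap.mul ℂ (Alt V₀)).compl₁₂ (altInterior (b.even j) ∘ₗ altSign V₀)
    (altInterior (b.even j))

/-- The Poisson bracket of `Sym(g₁)`:
`{F, G} = ∑ᵢ (∂F/∂pᵢ ∂G/∂qᵢ - ∂F/∂qᵢ ∂G/∂pᵢ)`, where `p₁, …, pₙ, q₁, …, qₙ` is the dual basis of
the Darboux basis `X₁, …, Xₙ, Y₁, …, Yₙ`, so that `∂/∂pᵢ = ∂_{Xᵢ}` and `∂/∂qᵢ = ∂_{Yᵢ}`. -/
def symPoisson (b : AdaptedBasis B) : Sym V₁ →ₗ[ℂ] Sym V₁ →ₗ[ℂ] Sym V₁ :=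
  ∑ i, ((LinearMap.mul ℂ (Sym V₁)).compl₁₂ (symDeriv (b.odd (.inl i))).toLinearMap
        (symDeriv (b.odd (.inr i))).toLinearMap -
      (LinearMap.mul ℂ (Sym V₁)).compl₁₂ (symDeriv (b.odd (.inr i))).toLinearMap
        (symDeriv (b.odd (.inl i))).toLinearMap)

/-- The super `ℤ × ℤ/2`-Poisson bracket of `E(g)`:
`{Ω ⊗ F, Ω' ⊗ F'} = (-1)^{f ω'} ({Ω, Ω'} ⊗ F F' + (Ω ∧ Ω') ⊗ {F, F'})`.
The map `poisson b A` is `ad_P(A)`. -/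
def poisson (b : AdaptedBasis B) :
    SuperExt V₀ V₁ →ₗ[ℂ] SuperExt V₀ V₁ →ₗ[ℂ] SuperExt V₀ V₁ :=
  twisted V₀ V₁ (altPoisson b) (LinearMap.mul ℂ (Sym V₁)) +
    twisted V₀ V₁ (LinearMap.mul ℂ (Alt V₀)) (symPoisson b)

theorem poisson_tmul (b : AdaptedBasis B) {f ω' : ℕ} (Ω : Alt V₀) {F : Sym V₁}
    (hF : F ∈ symPow V₁ f) {Ω' : Alt V₀} (hΩ' : Ω' ∈ altPow V₀ ω') (F' : Sym V₁) :
    poisson b (ofTensor V₀ V₁ (Ω ⊗ₜ[ℂ] F)) (ofTensor V₀ V₁ (Ω' ⊗ₜ[ℂ] F')) =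
      (-1 : ℂ) ^ (f * ω') • ofTensor V₀ V₁
        (altPoisson b Ω Ω' ⊗ₜ[ℂ] (F * F') + (Ω * Ω') ⊗ₜ[ℂ] symPoisson b F F') := by
  simp [poisson, twisted_tmul V₀ V₁ _ _ Ω hF hΩ' F']

end Forms

section Differential

variable {V₀ V₁ : Type*} [AddCommGroup V₀] [Module ℂ V₀] [AddCommGroup V₁] [Module ℂ V₁]

/-- The linear map `E(g) ⊗ g → End(E(g))` with `Ω ⊗ X ↦ -(-1)^{x ω} Ω ∧ ι_X` for `X ∈ g_x` and
`Ω ∈ E(g)` of parity `ω`. -/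
def superD : SuperExt V₀ V₁ ⊗[ℂ] (V₀ × V₁) →ₗ[ℂ] (SuperExt V₀ V₁ →ₗ[ℂ] SuperExt V₀ V₁) :=
  TensorProduct.lift (LinearMap.mk₂ ℂ
    (fun Ω X => -(LinearMap.mulLeft ℂ Ω ∘ₗ evenInterior X.1 +
      LinearMap.mulLeft ℂ (paritySign V₀ V₁ Ω) ∘ₗ oddInterior X.2))
    (fun Ω Ω' X => by
      refine LinearMap.ext fun A => ?_
      simp only [LinearMap.neg_apply, LinearMap.add_apply, LinearMap.comp_apply,
        LinearMap.mulLeft_apply, map_add, add_mul]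
      abel)
    (fun c Ω X => by
      refine LinearMap.ext fun A => ?_
      simp only [LinearMap.neg_apply, LinearMap.add_apply, LinearMap.comp_apply,
        LinearMap.smul_apply, LinearMap.mulLeft_apply, map_smul, smul_mul_assoc, smul_neg, smul_add])
    (fun Ω X Y => by
      refine LinearMap.ext fun A => ?_
      simp only [LinearMap.neg_apply, LinearMap.add_apply, LinearMap.comp_apply,
        LinearMap.mulLeft_apply, Prod.fst_add, Prod.snd_add, evenInterior_add, oddInterior_add,
        mul_add]
      abel)
    (fun c Ω X => by
      refine LinearMap.ext fun A => ?_
      simp only [LinearMap.neg_apply, LinearMap.add_apply, LinearMap.comp_apply,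
        LinearMap.smul_apply, LinearMap.mulLeft_apply, Prod.smul_fst, Prod.smul_snd,
        evenInterior_smul, oddInterior_smul, mul_smul_comm, smul_neg, smul_add]))

/-- An element of `E^2(g) ⊗ g` as a bilinear map `g × g → g`:
`(Ω ⊗ X)(Y, Z) = Ω(Y, Z) X`. -/
def toBilin (t : SuperExt V₀ V₁ ⊗[ℂ] (V₀ × V₁)) (Y Z : V₀ × V₁) : V₀ × V₁ :=
  TensorProduct.lid ℂ (V₀ × V₁) (LinearMap.rTensor (V₀ × V₁) (eval 2 ![Y, Z]) t)

/-- `d = D_F`: the endomorphism `d` of `E(g)` corresponds to the bilinear map `F` on `g`, that is,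
`d` is the image under `superD` of an element of `E^2(g) ⊗ g` that represents `F`. If `F` is a Lie
superalgebra structure, then `d` is the super-exterior differential of `(g, F)`. -/
def IsDifferential (F : V₀ × V₁ →ₗ[ℂ] V₀ × V₁ →ₗ[ℂ] V₀ × V₁)
    (d : SuperExt V₀ V₁ →ₗ[ℂ] SuperExt V₀ V₁) : Prop :=
  ∃ t : degree V₀ V₁ 2 ⊗[ℂ] (V₀ × V₁),
    (∀ Y Z, toBilin (LinearMap.rTensor (V₀ × V₁) (degree V₀ V₁ 2).subtype t) Y Z = F Y Z) ∧
      superD (LinearMap.rTensor (V₀ × V₁) (degree V₀ V₁ 2).subtype t) = d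

end Differential

end QuadSuper

end

/-! Filling the first argument of a form with a vector v is an operator `contr v` on E(g). The
contractions super-anticommute, and by `poisson_eq` the Poisson bracket is a sum of products of two
contractions (up to signs); hence the contractions are super-derivations of the bracket
(`contr_poisson`).

For I in E^{(3,0)}, `poisson_eq` also shows that -ad_P(I) is of the form D_F, with F obtained from I
by raising one index with B (`isDifferential_bracketOf`). Applying D_F to linear forms returns the
components of F, so no other F is possible. By cyclic symmetry of I this F satisfies B(F(X, Y), Z) =
I(X, Y, Z) (`bracketOf_spec`), and nondegeneracy of B turns the symmetries of I into evenness,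
antisymmetry and invariance of F.

Contracting {I, I} with X, Y, Z, T leaves, by the Leibniz rule, only the terms in which both factors
have become linear forms. These are B(F(X, Y), ·) and the like, and {B(U, ·), B(V, ·)} = B(U, V)
(`poisson_of_mem_one`). The six terms coincide in pairs, and by invariance the value of {I, I} is
twice the Jacobi expression paired with T (`eval_poisson_self`, `jacobi_pairing`). Forms are
determined by their values (Euler's formula) and B is nondegenerate, so {I, I} = 0 is the Jacobi
identity.

Conversely, an invariant structure gives an even super-antisymmetric trilinear form B([X, Y], Z).
Such a form comes from an element I of E^{(3,0)} (`exists_form_eq`), and nondegeneracy identifies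
the given bracket with the one built from I. Thus (A) and (C) follow from the computations for (B).
-/

open scoped TensorProduct DirectSum

noncomputable section

namespace QuadSuper

/-! ### Signs, interior products and Euler formulas on the two tensor factors. -/

section Factors

variable {V₀ V₁ : Type*} [AddCommGroup V₀] [Module ℂ V₀] [AddCommGroup V₁] [Module ℂ V₁]

theorem altSign_mul (Ω Ω' : Alt V₀) : altSign V₀ (Ω * Ω') = altSign V₀ Ω * altSign V₀ Ω' :=
  map_mul (CliffordAlgebra.involute : Alt V₀ →ₐ[ℂ] Alt V₀) Ω Ω'

theorem altSign_one : altSign V₀ 1 = 1 :=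
  map_one (CliffordAlgebra.involute : Alt V₀ →ₐ[ℂ] Alt V₀)

theorem altSign_ι (α : Module.Dual ℂ V₀) :
    altSign V₀ (ExteriorAlgebra.ι ℂ α) = -ExteriorAlgebra.ι ℂ α :=
  CliffordAlgebra.involute_ι α

theorem altSign_algebraMap (r : ℂ) :
    altSign V₀ (algebraMap ℂ (Alt V₀) r) = algebraMap ℂ (Alt V₀) r :=
  AlgHom.commutes (CliffordAlgebra.involute : Alt V₀ →ₐ[ℂ] Alt V₀) r

theorem altSign_altSign (Ω : Alt V₀) : altSign V₀ (altSign V₀ Ω) = Ω :=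
  CliffordAlgebra.involute_involute Ω

theorem symSign_mul (F G : Sym V₁) : symSign V₁ (F * G) = symSign V₁ F * symSign V₁ G :=
  map_mul (SymmetricAlgebra.lift (-(SymmetricAlgebra.ι ℂ (Module.Dual ℂ V₁))) :
    Sym V₁ →ₐ[ℂ] Sym V₁) F G

theorem symSign_algebraMap (r : ℂ) :
    symSign V₁ (algebraMap ℂ (Sym V₁) r) = algebraMap ℂ (Sym V₁) r :=
  AlgHom.commutes (SymmetricAlgebra.lift (-(SymmetricAlgebra.ι ℂ (Module.Dual ℂ V₁))) :
    Sym V₁ →ₐ[ℂ] Sym V₁) r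

theorem symSign_one : symSign V₁ 1 = 1 := by
  simpa using symSign_algebraMap (V₁ := V₁) 1

theorem symSign_ι (p : Module.Dual ℂ V₁) :
    symSign V₁ (SymmetricAlgebra.ι ℂ _ p) = -SymmetricAlgebra.ι ℂ _ p := by
  simp [symSign]

theorem symSign_symSign (F : Sym V₁) : symSign V₁ (symSign V₁ F) = F := by
  induction F using SymmetricAlgebra.induction with
  | algebraMap r => simp [symSign_algebraMap]
  | ι p => simp [symSign_ι]
  | mul F G hF hG => rw [symSign_mul, symSign_mul, hF, hG]
  | add F G hF hG => rw [map_add, map_add, hF, hG]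

theorem altInterior_algebraMap (X : V₀) (r : ℂ) :
    altInterior X (algebraMap ℂ (Alt V₀) r) = 0 :=
  CliffordAlgebra.contractLeft_algebraMap _ _ _

theorem altInterior_one (X : V₀) : altInterior X (1 : Alt V₀) = 0 :=
  CliffordAlgebra.contractLeft_one _ _

theorem altInterior_ι (X : V₀) (α : Module.Dual ℂ V₀) :
    altInterior X (ExteriorAlgebra.ι ℂ α) = algebraMap ℂ (Alt V₀) (α X) :=
  CliffordAlgebra.contractLeft_ι _ _ _

theorem altInterior_ι_mul (X : V₀) (α : Module.Dual ℂ V₀) (Ω : Alt V₀) :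
    altInterior X (ExteriorAlgebra.ι ℂ α * Ω) =
      α X • Ω - ExteriorAlgebra.ι ℂ α * altInterior X Ω :=
  CliffordAlgebra.contractLeft_ι_mul _ _ _

theorem altInterior_comm (X Y : V₀) (Ω : Alt V₀) :
    altInterior X (altInterior Y Ω) = -altInterior Y (altInterior X Ω) :=
  CliffordAlgebra.contractLeft_comm _ _ _

/-- Induction on `Alt(g₀)` by multiplication with linear forms on the left. -/
theorem alt_induction {P : Alt V₀ → Prop} (algebraMap : ∀ r, P (algebraMap ℂ (Alt V₀) r))
    (add : ∀ x y, P x → P y → P (x + y))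
    (ι_mul : ∀ x α, P x → P (ExteriorAlgebra.ι ℂ α * x)) (Ω : Alt V₀) : P Ω :=
  CliffordAlgebra.left_induction (0 : QuadraticForm ℂ (Module.Dual ℂ V₀)) algebraMap add ι_mul Ω

theorem altInterior_altSign (X : V₀) (Ω : Alt V₀) :
    altInterior X (altSign V₀ Ω) = -altSign V₀ (altInterior X Ω) := by
  induction Ω using alt_induction with
  | algebraMap r => rw [altSign_algebraMap, altInterior_algebraMap, map_zero, neg_zero]
  | add x y hx hy => simp only [map_add, hx, hy, neg_add]
  | ι_mul x α hx =>
    rw [altSign_mul, altSign_ι, neg_mul, map_neg, altInterior_ι_mul, altInterior_ι_mul, hx,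
      map_sub, map_smul, altSign_mul, altSign_ι]
    simp

theorem altInterior_mul (X : V₀) (Ω Ω' : Alt V₀) :
    altInterior X (Ω * Ω') = altInterior X Ω * Ω' + altSign V₀ Ω * altInterior X Ω' := by
  induction Ω using alt_induction with
  | algebraMap r =>
    rw [altSign_algebraMap, altInterior_algebraMap, ← Algebra.smul_def, ← Algebra.smul_def,
      map_smul, zero_mul, zero_add]
  | add x y hx hy => simp only [map_add, add_mul, hx, hy]; abel
  | ι_mul x α hx =>
    rw [mul_assoc, altInterior_ι_mul, altInterior_ι_mul, hx, altSign_mul, altSign_ι, sub_mul,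
      mul_add, smul_mul_assoc, mul_assoc, neg_mul, neg_mul, mul_assoc]
    abel

theorem altSign_of_mem {ω : ℕ} {Ω : Alt V₀} (h : Ω ∈ altPow V₀ ω) :
    altSign V₀ Ω = (-1 : ℂ) ^ ω • Ω := by
  induction h using Submodule.pow_induction_on_left' with
  | algebraMap r => rw [altSign_algebraMap, pow_zero, one_smul]
  | add x y i _ _ hx hy => rw [map_add, hx, hy, smul_add]
  | mem_mul m hm i x _ hx =>
    obtain ⟨α, rfl⟩ := hm
    rw [altSign_mul, altSign_ι, hx, pow_succ]
    simp

theorem symSign_of_mem {f : ℕ} {F : Sym V₁} (h : F ∈ symPow V₁ f) :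
    symSign V₁ F = (-1 : ℂ) ^ f • F := by
  unfold symPow at h
  induction h using Submodule.pow_induction_on_left' with
  | algebraMap r => rw [symSign_algebraMap, pow_zero, one_smul]
  | add x y i _ _ hx hy => rw [map_add, hx, hy, smul_add]
  | mem_mul m hm i x _ hx =>
    obtain ⟨α, rfl⟩ := hm
    rw [symSign_mul, symSign_ι, hx, pow_succ]
    simp

theorem altInterior_mem (X : V₀) {ω : ℕ} {Ω : Alt V₀} (h : Ω ∈ altPow V₀ ω) :
    (ω = 0 → altInterior X Ω = 0) ∧ ∀ k, ω = k + 1 → altInterior X Ω ∈ altPow V₀ k := by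
  induction h using Submodule.pow_induction_on_left' with
  | algebraMap r => simp [altInterior_algebraMap]
  | add x y i _ _ hx hy =>
    refine ⟨fun h => ?_, fun k h => ?_⟩
    · rw [map_add, hx.1 h, hy.1 h, add_zero]
    · rw [map_add]; exact add_mem (hx.2 k h) (hy.2 k h)
  | mem_mul m hm i x hx ih =>
    obtain ⟨α, rfl⟩ := hm
    refine ⟨fun h => by omega, fun k h => ?_⟩
    obtain rfl : i = k := by omega
    rw [altInterior_ι_mul]
    refine sub_mem (Submodule.smul_mem _ _ hx) ?_
    cases i with
    | zero => rw [ih.1 rfl, mul_zero]; exact zero_mem _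
    | succ j =>
      change _ ∈ LinearMap.range (ExteriorAlgebra.ι ℂ) ^ (j + 1)
      rw [pow_succ']
      exact Submodule.mul_mem_mul (LinearMap.mem_range_self _ _) (ih.2 j rfl)

theorem altInterior_mem_succ (X : V₀) {ω : ℕ} {Ω : Alt V₀} (h : Ω ∈ altPow V₀ (ω + 1)) :
    altInterior X Ω ∈ altPow V₀ ω :=
  (altInterior_mem X h).2 ω rfl

theorem altInterior_zero_of_mem (X : V₀) {Ω : Alt V₀} (h : Ω ∈ altPow V₀ 0) :
    altInterior X Ω = 0 :=
  (altInterior_mem X h).1 rfl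

theorem symDeriv_mem (X : V₁) {f : ℕ} {F : Sym V₁} (h : F ∈ symPow V₁ f) :
    (f = 0 → symDeriv X F = 0) ∧ ∀ k, f = k + 1 → symDeriv X F ∈ symPow V₁ k := by
  unfold symPow at h
  induction h using Submodule.pow_induction_on_left' with
  | algebraMap r => simp
  | add x y i _ _ hx hy =>
    refine ⟨fun h => ?_, fun k h => ?_⟩
    · rw [map_add, hx.1 h, hy.1 h, add_zero]
    · rw [map_add]; exact add_mem (hx.2 k h) (hy.2 k h)
  | mem_mul m hm i x hx ih =>
    obtain ⟨p, rfl⟩ := hm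
    refine ⟨fun h => by omega, fun k h => ?_⟩
    obtain rfl : i = k := by omega
    rw [Derivation.leibniz, symDeriv_ι, smul_eq_mul, smul_eq_mul, mul_comm x, ← Algebra.smul_def]
    refine add_mem ?_ (Submodule.smul_mem _ _ hx)
    cases i with
    | zero => rw [ih.1 rfl, mul_zero]; exact zero_mem _
    | succ j =>
      rw [symPow, pow_succ']
      exact Submodule.mul_mem_mul (LinearMap.mem_range_self _ _) (ih.2 j rfl)

theorem symDeriv_mem_succ (X : V₁) {f : ℕ} {F : Sym V₁} (h : F ∈ symPow V₁ (f + 1)) :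
    symDeriv X F ∈ symPow V₁ f :=
  (symDeriv_mem X h).2 f rfl

theorem symDeriv_zero_of_mem (X : V₁) {F : Sym V₁} (h : F ∈ symPow V₁ 0) :
    symDeriv X F = 0 :=
  (symDeriv_mem X h).1 rfl

theorem symDeriv_symSign (X : V₁) (F : Sym V₁) :
    symDeriv X (symSign V₁ F) = -symSign V₁ (symDeriv X F) := by
  induction F using SymmetricAlgebra.induction with
  | algebraMap r => simp [symSign_algebraMap]
  | ι p => simp [symSign_ι, symDeriv_ι, symSign_algebraMap]
  | mul F G hF hG =>
    simp only [symSign_mul, Derivation.leibniz, hF, hG, smul_eq_mul, map_add]; ring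
  | add F G hF hG => simp only [map_add, hF, hG, neg_add]

theorem symDeriv_comm (X Y : V₁) (F : Sym V₁) :
    symDeriv X (symDeriv Y F) = symDeriv Y (symDeriv X F) := by
  induction F using SymmetricAlgebra.induction with
  | algebraMap r => simp
  | ι p => simp [symDeriv_ι]
  | mul F G hF hG =>
    simp only [Derivation.leibniz, hF, hG, smul_eq_mul, map_add]; ring
  | add F G hF hG => simp only [map_add, hF, hG]

/-- Euler's formula on `Alt(g₀)`. -/
theorem alt_euler {κ : Type*} [Fintype κ] (e : Module.Basis κ ℂ V₀) {ω : ℕ} {Ω : Alt V₀}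
    (h : Ω ∈ altPow V₀ ω) :
    ∑ j, ExteriorAlgebra.ι ℂ (e.coord j) * altInterior (e j) Ω = (ω : ℂ) • Ω := by
  induction h using Submodule.pow_induction_on_left' with
  | algebraMap r => simp [altInterior_algebraMap]
  | add x y i _ _ hx hy => simp only [map_add, mul_add, Finset.sum_add_distrib, hx, hy, smul_add]
  | mem_mul m hm i x hx ih =>
    obtain ⟨α, rfl⟩ := hm
    -- Contracting the new factor α produces ∑ α(eⱼ) eʲ ∧ x = α ∧ x, one more copy of the form; this
    -- raises the eigenvalue from i to i + 1.
    have hα : ∑ j, α (e j) • e.coord j = α := by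
      refine e.ext fun k => ?_
      simp
    have hanti : ∀ j, ExteriorAlgebra.ι ℂ (e.coord j) * (ExteriorAlgebra.ι ℂ α *
        altInterior (e j) x) = -(ExteriorAlgebra.ι ℂ α * (ExteriorAlgebra.ι ℂ (e.coord j) *
        altInterior (e j) x)) := by
      intro j
      rw [← mul_assoc, ← mul_assoc, ← neg_mul,
        eq_neg_of_add_eq_zero_left (ExteriorAlgebra.ι_add_mul_swap (e.coord j) α)]
    have hsum : ∑ j, α (e j) • (ExteriorAlgebra.ι ℂ (e.coord j) * x) =
        ExteriorAlgebra.ι ℂ α * x := by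
      conv_rhs => rw [← hα]
      simp only [map_sum, map_smul, Finset.sum_mul, smul_mul_assoc]
    simp only [altInterior_ι_mul, mul_sub, mul_smul_comm, hanti, Finset.sum_sub_distrib, hsum,
      Finset.sum_neg_distrib, ← Finset.mul_sum, ih]
    push_cast
    rw [add_smul, one_smul, sub_neg_eq_add, add_comm]

/-- Euler's formula on `Sym(g₁)`. -/
theorem sym_euler {κ : Type*} [Fintype κ] (e : Module.Basis κ ℂ V₁) {f : ℕ} {F : Sym V₁}
    (h : F ∈ symPow V₁ f) :
    ∑ j, SymmetricAlgebra.ι ℂ _ (e.coord j) * symDeriv (e j) F = (f : ℂ) • F := by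
  unfold symPow at h
  induction h using Submodule.pow_induction_on_left' with
  | algebraMap r => simp
  | add x y i _ _ hx hy => simp only [map_add, mul_add, Finset.sum_add_distrib, hx, hy, smul_add]
  | mem_mul m hm i x hx ih =>
    obtain ⟨α, rfl⟩ := hm
    have hα : ∑ j, α (e j) • e.coord j = α := by
      refine e.ext fun k => ?_
      simp
    have hsum : ∑ j, α (e j) • (SymmetricAlgebra.ι ℂ _ (e.coord j) * x) =
        SymmetricAlgebra.ι ℂ _ α * x := by
      conv_rhs => rw [← hα]
      simp only [map_sum, map_smul, Finset.sum_mul, smul_mul_assoc]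
    have hterm : ∀ j, SymmetricAlgebra.ι ℂ _ (e.coord j) *
        symDeriv (e j) (SymmetricAlgebra.ι ℂ _ α * x) =
        SymmetricAlgebra.ι ℂ _ α * (SymmetricAlgebra.ι ℂ _ (e.coord j) * symDeriv (e j) x) +
          α (e j) • (SymmetricAlgebra.ι ℂ _ (e.coord j) * x) := by
      intro j
      rw [Derivation.leibniz, symDeriv_ι, smul_eq_mul, smul_eq_mul, Algebra.smul_def]
      ring
    simp only [hterm, Finset.sum_add_distrib, hsum, ← Finset.mul_sum, ih]
    push_cast
    rw [add_smul, one_smul, mul_smul_comm]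

end Factors

/-! ### Product, sign operators and contractions on the super-exterior algebra. -/

section SuperExterior

variable {V₀ V₁ : Type*} [AddCommGroup V₀] [Module ℂ V₀] [AddCommGroup V₁] [Module ℂ V₁]

theorem mapTensor_tmul (u : Alt V₀ →ₗ[ℂ] Alt V₀) (v : Sym V₁ →ₗ[ℂ] Sym V₁) (Ω : Alt V₀)
    (F : Sym V₁) :
    mapTensor V₀ V₁ u v (ofTensor V₀ V₁ (Ω ⊗ₜ[ℂ] F)) = ofTensor V₀ V₁ (u Ω ⊗ₜ[ℂ] v F) := rfl

/-- `E(g)` is spanned by the tensor products of homogeneous elements. -/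
theorem superExt_induction {P : SuperExt V₀ V₁ → Prop}
    (tmul : ∀ (ω f : ℕ), ∀ Ω ∈ altPow V₀ ω, ∀ F ∈ symPow V₁ f, P (ofTensor V₀ V₁ (Ω ⊗ₜ[ℂ] F)))
    (add : ∀ A A', P A → P A' → P (A + A')) (A : SuperExt V₀ V₁) : P A := by
  obtain ⟨T, rfl⟩ := (ofTensor V₀ V₁).surjective A
  have hzero : P 0 := by
    have := tmul 0 0 0 (zero_mem _) 0 (zero_mem _)
    rwa [TensorProduct.zero_tmul, map_zero] at this
  induction T using TensorProduct.induction_on with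
  | zero => rwa [map_zero]
  | add x y hx hy => rw [map_add]; exact add _ _ hx hy
  | tmul Ω F =>
    induction Ω using DirectSum.Decomposition.inductionOn (fun i : ℕ => altPow V₀ i) with
    | zero => rwa [TensorProduct.zero_tmul, map_zero]
    | add x y hx hy => rw [TensorProduct.add_tmul, map_add]; exact add _ _ hx hy
    | homogeneous Ω =>
      induction F using DirectSum.Decomposition.inductionOn (symPow V₁) with
      | zero => rwa [TensorProduct.tmul_zero, map_zero]
      | add x y hx hy => rw [TensorProduct.tmul_add, map_add]; exact add _ _ hx hy
      | homogeneous F => exact tmul _ _ _ Ω.2 _ F.2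

theorem altSign_pow_of_mem (k : ℕ) {i : ℕ} {Ω : Alt V₀} (hΩ : Ω ∈ altPow V₀ i) :
    (altSign V₀ ^ k) Ω = (-1 : ℂ) ^ (k * i) • Ω := by
  induction k with
  | zero => simp
  | succ k ih =>
    rw [pow_succ', Module.End.mul_apply, ih, map_smul, altSign_of_mem hΩ, smul_smul,
      ← pow_add, Nat.succ_mul]

/-- The Koszul sign is written as the operator `altSign ^ f`, so only F has to be homogeneous and
identities can be checked on arbitrary Ω'. -/
theorem tmul_mul_tmul {f : ℕ} (Ω : Alt V₀) {F : Sym V₁} (hF : F ∈ symPow V₁ f) (Ω' : Alt V₀)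
    (F' : Sym V₁) :
    ofTensor V₀ V₁ (Ω ⊗ₜ[ℂ] F) * ofTensor V₀ V₁ (Ω' ⊗ₜ[ℂ] F') =
      ofTensor V₀ V₁ ((Ω * (altSign V₀ ^ f) Ω') ⊗ₜ[ℂ] (F * F')) := by
  induction Ω' using DirectSum.Decomposition.inductionOn (fun i : ℕ => altPow V₀ i) with
  | zero => simp only [TensorProduct.zero_tmul, map_zero, mul_zero]
  | add x y hx hy => simp only [TensorProduct.add_tmul, map_add, mul_add, hx, hy]
  | @homogeneous i Ω' =>
    have h := GradedTensorProduct.tmul_coe_mul_coe_tmul (R := ℂ) (fun i : ℕ => altPow V₀ i)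
      (symPow V₁) Ω ⟨F, hF⟩ Ω' F'
    rw [altSign_pow_of_mem f Ω'.2]
    refine h.trans ?_
    rw [Units.smul_def, ← Int.cast_smul_eq_zsmul ℂ, mul_smul_comm, ← TensorProduct.smul_tmul',
      map_smul]
    congr 1
    push_cast [uzpow_natCast]
    simp

variable (V₀ V₁) in
/-- `A ↦ (-1)^ω A` for `A ∈ Alt^ω ⊗ Sym^f`. -/
def evenSign : SuperExt V₀ V₁ →ₗ[ℂ] SuperExt V₀ V₁ :=
  mapTensor V₀ V₁ (altSign V₀) LinearMap.id

variable (V₀ V₁) in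
/-- `A ↦ (-1)^n A` for `A ∈ E^n`. -/
def totalSign : SuperExt V₀ V₁ →ₗ[ℂ] SuperExt V₀ V₁ :=
  mapTensor V₀ V₁ (altSign V₀) (symSign V₁)

/-- The operator `Ω ⊗ F ↦ Ω ⊗ ∂_Y F`. -/
def oddDeriv (Y : V₁) : SuperExt V₀ V₁ →ₗ[ℂ] SuperExt V₀ V₁ :=
  mapTensor V₀ V₁ LinearMap.id (symDeriv Y).toLinearMap

theorem evenInterior_tmul (X : V₀) (Ω : Alt V₀) (F : Sym V₁) :
    evenInterior X (ofTensor V₀ V₁ (Ω ⊗ₜ[ℂ] F)) = ofTensor V₀ V₁ (altInterior X Ω ⊗ₜ[ℂ] F) := rfl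

theorem oddDeriv_tmul (Y : V₁) (Ω : Alt V₀) (F : Sym V₁) :
    oddDeriv Y (ofTensor V₀ V₁ (Ω ⊗ₜ[ℂ] F)) = ofTensor V₀ V₁ (Ω ⊗ₜ[ℂ] symDeriv Y F) := rfl

theorem evenSign_tmul (Ω : Alt V₀) (F : Sym V₁) :
    evenSign V₀ V₁ (ofTensor V₀ V₁ (Ω ⊗ₜ[ℂ] F)) = ofTensor V₀ V₁ (altSign V₀ Ω ⊗ₜ[ℂ] F) := rfl

theorem paritySign_tmul (Ω : Alt V₀) (F : Sym V₁) :
    paritySign V₀ V₁ (ofTensor V₀ V₁ (Ω ⊗ₜ[ℂ] F)) = ofTensor V₀ V₁ (Ω ⊗ₜ[ℂ] symSign V₁ F) := rfl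

theorem totalSign_tmul (Ω : Alt V₀) (F : Sym V₁) :
    totalSign V₀ V₁ (ofTensor V₀ V₁ (Ω ⊗ₜ[ℂ] F)) =
      ofTensor V₀ V₁ (altSign V₀ Ω ⊗ₜ[ℂ] symSign V₁ F) := rfl

theorem oddInterior_tmul (Y : V₁) (Ω : Alt V₀) (F : Sym V₁) :
    oddInterior Y (ofTensor V₀ V₁ (Ω ⊗ₜ[ℂ] F)) =
      -ofTensor V₀ V₁ (altSign V₀ Ω ⊗ₜ[ℂ] symDeriv Y F) := by
  rw [oddInterior, mapTensor_tmul, LinearMap.neg_apply, TensorProduct.tmul_neg, map_neg]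
  rfl

/-- Two linear maps on `E(g)` agree if they agree on pure tensors. -/
theorem linearMap_ext_tmul {M : Type*} [AddCommGroup M] [Module ℂ M]
    {φ ψ : SuperExt V₀ V₁ →ₗ[ℂ] M}
    (h : ∀ Ω F, φ (ofTensor V₀ V₁ (Ω ⊗ₜ[ℂ] F)) = ψ (ofTensor V₀ V₁ (Ω ⊗ₜ[ℂ] F)))
    (A : SuperExt V₀ V₁) : φ A = ψ A := by
  induction A using superExt_induction with
  | tmul ω f Ω _ F _ => exact h Ω F
  | add A A' hA hA' => rw [map_add, map_add, hA, hA']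

section Commutation

variable (X X' : V₀) (Y Y' : V₁) (A : SuperExt V₀ V₁)

theorem totalSign_eq : totalSign V₀ V₁ A = evenSign V₀ V₁ (paritySign V₀ V₁ A) :=
  linearMap_ext_tmul (φ := totalSign V₀ V₁) (ψ := evenSign V₀ V₁ ∘ₗ paritySign V₀ V₁)
    (fun _ _ => rfl) A

theorem evenSign_evenSign : evenSign V₀ V₁ (evenSign V₀ V₁ A) = A :=
  linearMap_ext_tmul (φ := evenSign V₀ V₁ ∘ₗ evenSign V₀ V₁) (ψ := LinearMap.id)
    (fun Ω F => by simp [evenSign_tmul, altSign_altSign]) A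

theorem paritySign_paritySign : paritySign V₀ V₁ (paritySign V₀ V₁ A) = A :=
  linearMap_ext_tmul (φ := paritySign V₀ V₁ ∘ₗ paritySign V₀ V₁) (ψ := LinearMap.id)
    (fun Ω F => by simp [paritySign_tmul, symSign_symSign]) A

theorem paritySign_evenSign :
    paritySign V₀ V₁ (evenSign V₀ V₁ A) = evenSign V₀ V₁ (paritySign V₀ V₁ A) :=
  linearMap_ext_tmul (φ := paritySign V₀ V₁ ∘ₗ evenSign V₀ V₁)
    (ψ := evenSign V₀ V₁ ∘ₗ paritySign V₀ V₁) (fun _ _ => rfl) A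

theorem evenInterior_evenSign :
    evenInterior X (evenSign V₀ V₁ A) = -evenSign V₀ V₁ (evenInterior X A) :=
  linearMap_ext_tmul (φ := evenInterior X ∘ₗ evenSign V₀ V₁)
    (ψ := -(evenSign V₀ V₁ ∘ₗ evenInterior X)) (fun Ω F => by
      simp [evenSign_tmul, evenInterior_tmul, altInterior_altSign, TensorProduct.neg_tmul]) A

theorem evenInterior_paritySign :
    evenInterior X (paritySign V₀ V₁ A) = paritySign V₀ V₁ (evenInterior X A) :=
  linearMap_ext_tmul (φ := evenInterior X ∘ₗ paritySign V₀ V₁)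
    (ψ := paritySign V₀ V₁ ∘ₗ evenInterior X) (fun _ _ => rfl) A

theorem oddDeriv_evenSign :
    oddDeriv Y (evenSign V₀ V₁ A) = evenSign V₀ V₁ (oddDeriv Y A) :=
  linearMap_ext_tmul (φ := oddDeriv Y ∘ₗ evenSign V₀ V₁)
    (ψ := evenSign V₀ V₁ ∘ₗ oddDeriv Y) (fun _ _ => rfl) A

theorem oddDeriv_paritySign :
    oddDeriv Y (paritySign V₀ V₁ A) = -paritySign V₀ V₁ (oddDeriv Y A) :=
  linearMap_ext_tmul (φ := oddDeriv Y ∘ₗ paritySign V₀ V₁)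
    (ψ := -(paritySign V₀ V₁ ∘ₗ oddDeriv Y)) (fun Ω F => by
      simp [paritySign_tmul, oddDeriv_tmul, symDeriv_symSign, TensorProduct.tmul_neg]) A

theorem evenInterior_comm :
    evenInterior X (evenInterior X' A) = -evenInterior X' (evenInterior X A) :=
  linearMap_ext_tmul (φ := evenInterior X ∘ₗ evenInterior X')
    (ψ := -(evenInterior X' ∘ₗ evenInterior X)) (fun Ω F => by
      simp [evenInterior_tmul, altInterior_comm X, TensorProduct.neg_tmul]) A

theorem oddDeriv_comm : oddDeriv Y (oddDeriv Y' A) = oddDeriv Y' (oddDeriv Y A) :=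
  linearMap_ext_tmul (φ := oddDeriv Y ∘ₗ oddDeriv Y')
    (ψ := oddDeriv Y' ∘ₗ oddDeriv Y) (fun Ω F => by
      simp [oddDeriv_tmul, symDeriv_comm Y]) A

theorem evenInterior_oddDeriv :
    evenInterior X (oddDeriv Y A) = oddDeriv Y (evenInterior X A) :=
  linearMap_ext_tmul (φ := evenInterior X ∘ₗ oddDeriv Y)
    (ψ := oddDeriv Y ∘ₗ evenInterior X) (fun _ _ => rfl) A

/-- Separates the sign from the derivative. Later computations use `oddDeriv`, which commutes with
the even contractions and with itself. -/
theorem oddInterior_eq : oddInterior Y A = -evenSign V₀ V₁ (oddDeriv Y A) :=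
  linearMap_ext_tmul (ψ := -(evenSign V₀ V₁ ∘ₗ oddDeriv Y)) (fun Ω F => by
    rw [oddInterior_tmul]; rfl) A

theorem evenInterior_totalSign :
    evenInterior X (totalSign V₀ V₁ A) = -totalSign V₀ V₁ (evenInterior X A) := by
  rw [totalSign_eq, totalSign_eq, evenInterior_evenSign, evenInterior_paritySign]

theorem oddDeriv_totalSign :
    oddDeriv Y (totalSign V₀ V₁ A) = -totalSign V₀ V₁ (oddDeriv Y A) := by
  rw [totalSign_eq, totalSign_eq, oddDeriv_evenSign, oddDeriv_paritySign, map_neg]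

theorem totalSign_totalSign : totalSign V₀ V₁ (totalSign V₀ V₁ A) = A := by
  rw [totalSign_eq, totalSign_eq, paritySign_evenSign, evenSign_evenSign, paritySign_paritySign]

theorem evenSign_totalSign : evenSign V₀ V₁ (totalSign V₀ V₁ A) = paritySign V₀ V₁ A := by
  rw [totalSign_eq, evenSign_evenSign]

end Commutation

theorem altSign_pow_comm (f : ℕ) (Ω : Alt V₀) :
    (altSign V₀ ^ f) (altSign V₀ Ω) = altSign V₀ ((altSign V₀ ^ f) Ω) := by
  rw [← Module.End.mul_apply, ← Module.End.mul_apply, ← pow_succ, ← pow_succ']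

theorem altInterior_altSign_pow (X : V₀) (f : ℕ) (Ω : Alt V₀) :
    altInterior X ((altSign V₀ ^ f) Ω) = (-1 : ℂ) ^ f • (altSign V₀ ^ f) (altInterior X Ω) := by
  induction f with
  | zero => simp
  | succ f ih =>
    rw [pow_succ', Module.End.mul_apply, altInterior_altSign, ih, map_smul, Module.End.mul_apply,
      pow_succ', neg_one_mul, neg_smul]

/-- A multiplicative identity on `E(g)` may be checked on pure tensors. -/
theorem mul_identity_ext {φ : SuperExt V₀ V₁ →ₗ[ℂ] SuperExt V₀ V₁ →ₗ[ℂ] SuperExt V₀ V₁}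
    {ψ : SuperExt V₀ V₁ →ₗ[ℂ] SuperExt V₀ V₁ →ₗ[ℂ] SuperExt V₀ V₁}
    (h : ∀ (f : ℕ) (Ω : Alt V₀), ∀ F ∈ symPow V₁ f, ∀ Ω' F',
      φ (ofTensor V₀ V₁ (Ω ⊗ₜ[ℂ] F)) (ofTensor V₀ V₁ (Ω' ⊗ₜ[ℂ] F')) =
        ψ (ofTensor V₀ V₁ (Ω ⊗ₜ[ℂ] F)) (ofTensor V₀ V₁ (Ω' ⊗ₜ[ℂ] F')))
    (A A' : SuperExt V₀ V₁) : φ A A' = ψ A A' := by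
  induction A using superExt_induction with
  | tmul ω f Ω _ F hF => exact linearMap_ext_tmul (h f Ω F hF) A'
  | add A B hA hB => rw [map_add, map_add, LinearMap.add_apply, LinearMap.add_apply, hA, hB]

theorem evenSign_mul (A A' : SuperExt V₀ V₁) :
    evenSign V₀ V₁ (A * A') = evenSign V₀ V₁ A * evenSign V₀ V₁ A' :=
  mul_identity_ext (φ := (LinearMap.mul ℂ (SuperExt V₀ V₁)).compr₂ (evenSign V₀ V₁))
    (ψ := (LinearMap.mul ℂ (SuperExt V₀ V₁)).compl₁₂ (evenSign V₀ V₁) (evenSign V₀ V₁))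
    (fun f Ω F hF Ω' F' => by
      simp only [LinearMap.compr₂_apply, LinearMap.compl₁₂_apply, LinearMap.mul_apply',
        evenSign_tmul, tmul_mul_tmul _ hF, altSign_mul, altSign_pow_comm]) A A'

theorem symSign_mem {f : ℕ} {F : Sym V₁} (hF : F ∈ symPow V₁ f) : symSign V₁ F ∈ symPow V₁ f := by
  rw [symSign_of_mem hF]
  exact Submodule.smul_mem _ _ hF

theorem paritySign_mul (A A' : SuperExt V₀ V₁) :
    paritySign V₀ V₁ (A * A') = paritySign V₀ V₁ A * paritySign V₀ V₁ A' :=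
  mul_identity_ext (φ := (LinearMap.mul ℂ (SuperExt V₀ V₁)).compr₂ (paritySign V₀ V₁))
    (ψ := (LinearMap.mul ℂ (SuperExt V₀ V₁)).compl₁₂ (paritySign V₀ V₁) (paritySign V₀ V₁))
    (fun f Ω F hF Ω' F' => by
      simp only [LinearMap.compr₂_apply, LinearMap.compl₁₂_apply, LinearMap.mul_apply',
        paritySign_tmul, tmul_mul_tmul _ hF, tmul_mul_tmul _ (symSign_mem hF), symSign_mul]) A A'

theorem totalSign_mul (A A' : SuperExt V₀ V₁) :
    totalSign V₀ V₁ (A * A') = totalSign V₀ V₁ A * totalSign V₀ V₁ A' := by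
  simp only [totalSign_eq, paritySign_mul, evenSign_mul]

theorem evenInterior_mul (X : V₀) (A A' : SuperExt V₀ V₁) :
    evenInterior X (A * A') = evenInterior X A * A' + totalSign V₀ V₁ A * evenInterior X A' :=
  mul_identity_ext (φ := (LinearMap.mul ℂ (SuperExt V₀ V₁)).compr₂ (evenInterior X))
    (ψ := (LinearMap.mul ℂ (SuperExt V₀ V₁)).compl₁₂ (evenInterior X) LinearMap.id +
      (LinearMap.mul ℂ (SuperExt V₀ V₁)).compl₁₂ (totalSign V₀ V₁) (evenInterior X))
    (fun f Ω F hF Ω' F' => by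
      simp only [LinearMap.compr₂_apply, LinearMap.compl₁₂_apply, LinearMap.mul_apply',
        LinearMap.add_apply, LinearMap.id_apply, evenInterior_tmul, totalSign_tmul,
        tmul_mul_tmul _ hF, tmul_mul_tmul _ (symSign_mem hF), altInterior_mul,
        altInterior_altSign_pow, TensorProduct.add_tmul, map_add]
      rw [symSign_of_mem hF, mul_smul_comm, smul_mul_assoc, TensorProduct.smul_tmul]) A A'

/-- The twist falls on the right factor: ∂F has degree f - 1, so moving it past Ω' costs one sign
(-1)^ω' less than moving F. -/
theorem oddDeriv_mul (Y : V₁) (A A' : SuperExt V₀ V₁) :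
    oddDeriv Y (A * A') = oddDeriv Y A * evenSign V₀ V₁ A' + A * oddDeriv Y A' :=
  mul_identity_ext (φ := (LinearMap.mul ℂ (SuperExt V₀ V₁)).compr₂ (oddDeriv Y))
    (ψ := (LinearMap.mul ℂ (SuperExt V₀ V₁)).compl₁₂ (oddDeriv Y) (evenSign V₀ V₁) +
      (LinearMap.mul ℂ (SuperExt V₀ V₁)).compl₁₂ LinearMap.id (oddDeriv Y))
    (fun f Ω F hF Ω' F' => by
      simp only [LinearMap.compr₂_apply, LinearMap.compl₁₂_apply, LinearMap.mul_apply',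
        LinearMap.add_apply, LinearMap.id_apply, oddDeriv_tmul, evenSign_tmul,
        tmul_mul_tmul _ hF, Derivation.leibniz, smul_eq_mul, TensorProduct.tmul_add, map_add]
      rw [add_comm]
      congr 1
      cases f with
      | zero => simp [symDeriv_zero_of_mem Y hF]
      | succ k =>
        rw [tmul_mul_tmul _ (symDeriv_mem_succ Y hF), mul_comm F', pow_succ, Module.End.mul_apply])
    A A'

end SuperExterior

/-! ### Leibniz rules for the Poisson bracket, and contraction by a general vector. -/

section PoissonLeibniz

variable {V₀ V₁ : Type*} [AddCommGroup V₀] [Module ℂ V₀] [AddCommGroup V₁] [Module ℂ V₁]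
variable {B : LinearMap.BilinForm ℂ (V₀ × V₁)}

theorem twisted_tmul_pow (m : Alt V₀ →ₗ[ℂ] Alt V₀ →ₗ[ℂ] Alt V₀)
    (m' : Sym V₁ →ₗ[ℂ] Sym V₁ →ₗ[ℂ] Sym V₁) {f : ℕ} (Ω : Alt V₀) {F : Sym V₁}
    (hF : F ∈ symPow V₁ f) (Ω' : Alt V₀) (F' : Sym V₁) :
    twisted V₀ V₁ m m' (ofTensor V₀ V₁ (Ω ⊗ₜ[ℂ] F)) (ofTensor V₀ V₁ (Ω' ⊗ₜ[ℂ] F')) =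
      ofTensor V₀ V₁ (m Ω ((altSign V₀ ^ f) Ω') ⊗ₜ[ℂ] m' F F') := by
  induction Ω' using DirectSum.Decomposition.inductionOn (fun i : ℕ => altPow V₀ i) with
  | zero => simp only [TensorProduct.zero_tmul, map_zero]
  | add x y hx hy => simp only [TensorProduct.add_tmul, map_add, hx, hy]
  | homogeneous Ω' =>
    rw [twisted_tmul V₀ V₁ m m' Ω hF Ω'.2, altSign_pow_of_mem f Ω'.2, map_smul,
      ← TensorProduct.smul_tmul', map_smul]

/-- The Poisson bracket in terms of interior products and the super-exterior product. -/
theorem poisson_eq (b : AdaptedBasis B) (A A' : SuperExt V₀ V₁) :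
    poisson b A A' =
      ∑ j, -(evenInterior (b.even j) (totalSign V₀ V₁ A) * evenInterior (b.even j) A') +
      ∑ i, (oddDeriv (b.odd (.inl i)) A * evenSign V₀ V₁ (oddDeriv (b.odd (.inr i)) A') -
        oddDeriv (b.odd (.inr i)) A * evenSign V₀ V₁ (oddDeriv (b.odd (.inl i)) A')) := by
  -- `evenSign` supplies the power of `altSign` lost because ∂F lies in Sym^{f-1}. For f = 0 there
  -- is no such degree, but then ∂F = 0.
  have key : ∀ (Y Y' : V₁) (f : ℕ) (Ω : Alt V₀), ∀ F ∈ symPow V₁ f, ∀ Ω' F',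
      oddDeriv Y (ofTensor V₀ V₁ (Ω ⊗ₜ[ℂ] F)) *
        evenSign V₀ V₁ (oddDeriv Y' (ofTensor V₀ V₁ (Ω' ⊗ₜ[ℂ] F'))) =
      ofTensor V₀ V₁ ((Ω * (altSign V₀ ^ f) Ω') ⊗ₜ[ℂ] (symDeriv Y F * symDeriv Y' F')) := by
    intro Y Y' f Ω F hF Ω' F'
    rw [oddDeriv_tmul, oddDeriv_tmul, evenSign_tmul]
    cases f with
    | zero => simp [symDeriv_zero_of_mem Y hF]
    | succ k =>
      rw [tmul_mul_tmul _ (symDeriv_mem_succ Y hF), pow_succ, Module.End.mul_apply]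
  refine (mul_identity_ext (φ := poisson b)
    (ψ := ∑ j, -(LinearMap.mul ℂ (SuperExt V₀ V₁)).compl₁₂
        (evenInterior (b.even j) ∘ₗ totalSign V₀ V₁) (evenInterior (b.even j)) +
      ∑ i, ((LinearMap.mul ℂ (SuperExt V₀ V₁)).compl₁₂ (oddDeriv (b.odd (.inl i)))
          (evenSign V₀ V₁ ∘ₗ oddDeriv (b.odd (.inr i))) -
        (LinearMap.mul ℂ (SuperExt V₀ V₁)).compl₁₂ (oddDeriv (b.odd (.inr i)))
          (evenSign V₀ V₁ ∘ₗ oddDeriv (b.odd (.inl i))))) ?_ A A').trans ?_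
  · intro f Ω F hF Ω' F'
    rw [poisson, LinearMap.add_apply, LinearMap.add_apply, twisted_tmul_pow _ _ _ hF,
      twisted_tmul_pow _ _ _ hF]
    simp only [altPoisson, symPoisson, LinearMap.add_apply, LinearMap.sum_apply,
      LinearMap.neg_apply, LinearMap.sub_apply, LinearMap.compl₁₂_apply, LinearMap.comp_apply,
      LinearMap.mul_apply', key _ _ f Ω F hF, totalSign_tmul, evenInterior_tmul,
      tmul_mul_tmul _ (symSign_mem hF)]
    congr 1
    · rw [TensorProduct.neg_tmul, TensorProduct.sum_tmul, map_neg, map_sum,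
        ← Finset.sum_neg_distrib]
      refine Finset.sum_congr rfl fun j _ => ?_
      -- Moving the interior product past `altSign ^ f` gives (-1)^f, the same sign that `totalSign`
      -- puts on F.
      rw [altInterior_altSign_pow, symSign_of_mem hF, mul_smul_comm, smul_mul_assoc,
        TensorProduct.smul_tmul]
    · rw [TensorProduct.tmul_sum, map_sum]
      refine Finset.sum_congr rfl fun i _ => ?_
      rw [TensorProduct.tmul_sub, map_sub]
      rfl
  · simp only [LinearMap.add_apply, LinearMap.sum_apply,
      LinearMap.neg_apply, LinearMap.sub_apply, LinearMap.compl₁₂_apply, LinearMap.comp_apply,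
      LinearMap.mul_apply']

/-- The bracket is a sum of products of contractions, so the rule follows from the Leibniz rule for
products and the (anti)commutation of contractions. -/
theorem evenInterior_poisson (b : AdaptedBasis B) (X : V₀) (A A' : SuperExt V₀ V₁) :
    evenInterior X (poisson b A A') =
      poisson b (evenInterior X A) A' + poisson b (totalSign V₀ V₁ A) (evenInterior X A') := by
  rw [poisson_eq, poisson_eq, poisson_eq, map_add, map_sum, map_sum, add_add_add_comm,
    ← Finset.sum_add_distrib, ← Finset.sum_add_distrib]
  congr 1 <;> refine Finset.sum_congr rfl fun j _ => ?_
  · simp only [map_neg, evenInterior_mul, evenInterior_comm X, evenInterior_totalSign,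
      totalSign_totalSign, neg_neg, neg_mul, mul_neg]
  · simp only [map_sub, evenInterior_mul, evenInterior_evenSign, evenInterior_oddDeriv,
      oddDeriv_totalSign, neg_mul, mul_neg]
    abel

theorem oddDeriv_poisson (b : AdaptedBasis B) (Y : V₁) (A A' : SuperExt V₀ V₁) :
    oddDeriv Y (poisson b A A') =
      poisson b (oddDeriv Y A) (evenSign V₀ V₁ A') + poisson b A (oddDeriv Y A') := by
  rw [poisson_eq, poisson_eq, poisson_eq, map_add, map_sum, map_sum, add_add_add_comm,
    ← Finset.sum_add_distrib, ← Finset.sum_add_distrib]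
  congr 1 <;> refine Finset.sum_congr rfl fun j _ => ?_
  · simp only [map_neg, oddDeriv_mul, ← evenInterior_oddDeriv, oddDeriv_totalSign,
      evenInterior_evenSign, neg_neg, neg_mul, mul_neg]
    abel
  · simp only [map_sub, oddDeriv_mul, oddDeriv_evenSign, oddDeriv_comm Y]
    abel

theorem totalSign_poisson (b : AdaptedBasis B) (A A' : SuperExt V₀ V₁) :
    totalSign V₀ V₁ (poisson b A A') = poisson b (totalSign V₀ V₁ A) (totalSign V₀ V₁ A') := by
  have hs : ∀ C : SuperExt V₀ V₁,
      totalSign V₀ V₁ (evenSign V₀ V₁ C) = evenSign V₀ V₁ (totalSign V₀ V₁ C) := fun C => by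
    rw [totalSign_eq, totalSign_eq, paritySign_evenSign]
  rw [poisson_eq, poisson_eq, map_add, map_sum, map_sum]
  congr 1 <;> refine Finset.sum_congr rfl fun j _ => ?_
  · simp only [map_neg, totalSign_mul, evenInterior_totalSign, neg_neg, neg_mul, mul_neg]
  · simp only [map_sub, map_neg, totalSign_mul, hs, oddDeriv_totalSign, neg_neg, neg_mul, mul_neg]

variable (V₀ V₁) in
/-- The contraction of forms by their first argument. -/
def contr : V₀ × V₁ →ₗ[ℂ] SuperExt V₀ V₁ →ₗ[ℂ] SuperExt V₀ V₁ where
  toFun v := evenInterior v.1 + oddInterior v.2 ∘ₗ paritySign V₀ V₁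
  map_add' v w := by
    refine LinearMap.ext fun A => ?_
    simp only [LinearMap.add_apply, LinearMap.comp_apply, Prod.fst_add, Prod.snd_add,
      evenInterior_add, oddInterior_add]
    abel
  map_smul' c v := by
    refine LinearMap.ext fun A => ?_
    simp only [LinearMap.add_apply, LinearMap.smul_apply, LinearMap.comp_apply, Prod.smul_fst,
      Prod.smul_snd, evenInterior_smul, oddInterior_smul, RingHom.id_apply, smul_add]

theorem eval_succ {n : ℕ} (v : Fin (n + 1) → V₀ × V₁) (A : SuperExt V₀ V₁) :
    eval (n + 1) v A = eval n (Fin.tail v) (contr V₀ V₁ (v 0) A) := rfl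

/-- The sign (-1)^b in the values of a form and the sign (-1)^ω in ι_X combine to the sign of the
total degree, which is a scalar on each E^n. -/
theorem contr_eq (v : V₀ × V₁) (A : SuperExt V₀ V₁) :
    contr V₀ V₁ v A = evenInterior v.1 A - oddDeriv v.2 (totalSign V₀ V₁ A) := by
  change evenInterior v.1 A + oddInterior v.2 (paritySign V₀ V₁ A) = _
  rw [oddInterior_eq, totalSign_eq, oddDeriv_evenSign, sub_eq_add_neg]

theorem oddDeriv_zero (A : SuperExt V₀ V₁) : oddDeriv (0 : V₁) A = 0 := by
  have h : symDeriv (0 : V₁) = (0 : Derivation ℂ (Sym V₁) (Sym V₁)) := by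
    ext F
    have := symDeriv_add_smul 1 (0 : V₁) 0 F
    simpa using this
  rw [oddDeriv, h]
  exact linearMap_ext_tmul (ψ := 0) (fun Ω F => by
    rw [mapTensor_tmul]
    simp) A

theorem evenInterior_zero (A : SuperExt V₀ V₁) : evenInterior (0 : V₀) A = 0 := by
  simpa using evenInterior_smul 0 (0 : V₀) A

theorem contr_even (X : V₀) (A : SuperExt V₀ V₁) :
    contr V₀ V₁ (X, 0) A = evenInterior X A := by
  rw [contr_eq, oddDeriv_zero, sub_zero]

theorem contr_odd (Y : V₁) (A : SuperExt V₀ V₁) :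
    contr V₀ V₁ (0, Y) A = -oddDeriv Y (totalSign V₀ V₁ A) := by
  rw [contr_eq, evenInterior_zero, zero_sub]

theorem zmod_two_cases (x : ZMod 2) : x = 0 ∨ x = 1 := by
  revert x; decide

/-- A homogeneous vector is of the form `(X, 0)` or `(0, Y)`. -/
theorem part_cases {P : ZMod 2 → V₀ × V₁ → Prop} (even : ∀ X, P 0 (X, 0)) (odd : ∀ Y, P 1 (0, Y))
    {x : ZMod 2} {X : V₀ × V₁} (hX : X ∈ part V₀ V₁ x) : P x X := by
  rcases zmod_two_cases x with rfl | rfl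
  · rw [part, if_pos rfl] at hX
    obtain ⟨X, rfl⟩ := hX
    exact even X
  · rw [part, if_neg one_ne_zero] at hX
    obtain ⟨X, rfl⟩ := hX
    exact odd X

theorem even_mem_part (X : V₀) : ((X, 0) : V₀ × V₁) ∈ part V₀ V₁ 0 := by
  simp [part]

theorem odd_mem_part (Y : V₁) : ((0, Y) : V₀ × V₁) ∈ part V₀ V₁ 1 := by
  simp [part]

theorem sgn_zero_left (y : ZMod 2) : sgn 0 y = 1 := by simp [sgn]

theorem sgn_zero_right (y : ZMod 2) : sgn y 0 = 1 := by simp [sgn]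

theorem sgn_one_one : sgn 1 1 = -1 := by simp [sgn, ZMod.val_one]

theorem sgn_comm (x y : ZMod 2) : sgn x y = sgn y x := by rw [sgn, sgn, mul_comm]

theorem sgn_add_right (x y z : ZMod 2) : sgn x (y + z) = sgn x y * sgn x z := by
  have h2 : (1 : ZMod 2) + 1 = 0 := rfl
  rcases zmod_two_cases x with rfl | rfl <;> rcases zmod_two_cases y with rfl | rfl <;>
    rcases zmod_two_cases z with rfl | rfl <;>
    simp [sgn_zero_left, sgn_zero_right, sgn_one_one, h2]

theorem sgn_mul_self (x y : ZMod 2) : sgn x y * sgn x y = 1 := by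
  rw [sgn, ← pow_add, ← two_mul, pow_mul]; simp

/-- The contractions super-anticommute. -/
theorem contr_comm {x y : ZMod 2} {X Y : V₀ × V₁} (hX : X ∈ part V₀ V₁ x)
    (hY : Y ∈ part V₀ V₁ y) (A : SuperExt V₀ V₁) :
    contr V₀ V₁ X (contr V₀ V₁ Y A) = -sgn x y • contr V₀ V₁ Y (contr V₀ V₁ X A) := by
  refine part_cases (P := fun x X => contr V₀ V₁ X (contr V₀ V₁ Y A) =
    -sgn x y • contr V₀ V₁ Y (contr V₀ V₁ X A)) (fun X => ?_) (fun X => ?_) hX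
  · refine part_cases (P := fun y Y => contr V₀ V₁ (X, 0) (contr V₀ V₁ Y A) =
      -sgn 0 y • contr V₀ V₁ Y (contr V₀ V₁ (X, 0) A)) (fun Y => ?_) (fun Y => ?_) hY
    · simp only [contr_even, evenInterior_comm X, sgn_zero_left, neg_smul, one_smul]
    · simp only [contr_even, contr_odd, sgn_zero_left, neg_smul, one_smul, map_neg,
        evenInterior_oddDeriv, evenInterior_totalSign]
  · refine part_cases (P := fun y Y => contr V₀ V₁ (0, X) (contr V₀ V₁ Y A) =
      -sgn 1 y • contr V₀ V₁ Y (contr V₀ V₁ (0, X) A)) (fun Y => ?_) (fun Y => ?_) hY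
    · simp only [contr_even, contr_odd, sgn_zero_right, neg_smul, one_smul, map_neg,
        evenInterior_oddDeriv, evenInterior_totalSign, neg_neg]
    · simp only [contr_odd, sgn_one_one, neg_neg, one_smul, map_neg, oddDeriv_totalSign,
        oddDeriv_comm X]

theorem paritySign_contr {x : ZMod 2} {X : V₀ × V₁} (hX : X ∈ part V₀ V₁ x)
    (A : SuperExt V₀ V₁) :
    paritySign V₀ V₁ (contr V₀ V₁ X A) = sgn 1 x • contr V₀ V₁ X (paritySign V₀ V₁ A) := by
  refine part_cases (P := fun x X => paritySign V₀ V₁ (contr V₀ V₁ X A) =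
    sgn 1 x • contr V₀ V₁ X (paritySign V₀ V₁ A)) (fun X => ?_) (fun X => ?_) hX
  · rw [contr_even, contr_even, evenInterior_paritySign, sgn_zero_right, one_smul]
  · rw [contr_odd, contr_odd, totalSign_eq, totalSign_eq, ← paritySign_evenSign,
      oddDeriv_paritySign, ← paritySign_evenSign, oddDeriv_paritySign, sgn_one_one]
    simp [paritySign_evenSign, oddDeriv_evenSign, oddDeriv_paritySign]

/-- The contractions are super-derivations of the Poisson bracket. -/
theorem contr_poisson (b : AdaptedBasis B) {x y : ZMod 2} {X : V₀ × V₁} (hX : X ∈ part V₀ V₁ x)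
    (A : SuperExt V₀ V₁) {A' : SuperExt V₀ V₁} (hA' : paritySign V₀ V₁ A' = sgn 1 y • A') :
    contr V₀ V₁ X (poisson b A A') = sgn x y • poisson b (contr V₀ V₁ X A) A' +
      poisson b (totalSign V₀ V₁ A) (contr V₀ V₁ X A') := by
  refine part_cases (P := fun x X => contr V₀ V₁ X (poisson b A A') =
    sgn x y • poisson b (contr V₀ V₁ X A) A' + poisson b (totalSign V₀ V₁ A) (contr V₀ V₁ X A'))
    (fun X => ?_) (fun X => ?_) hX
  · simp only [contr_even, evenInterior_poisson, sgn_zero_left, one_smul]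
  · rw [contr_odd, totalSign_poisson, oddDeriv_poisson, evenSign_totalSign, hA', contr_odd,
      contr_odd, map_smul, map_neg, map_neg, LinearMap.neg_apply, neg_add, smul_neg]

end PoissonLeibniz

/-! ### Degrees, and the determination of a form by its values. -/

section Degrees

variable {V₀ V₁ : Type*} [AddCommGroup V₀] [Module ℂ V₀] [AddCommGroup V₁] [Module ℂ V₁]
variable {B : LinearMap.BilinForm ℂ (V₀ × V₁)}

theorem tensorPart_le {ω f : ℕ} {S : Submodule ℂ (SuperExt V₀ V₁)}
    (h : ∀ Ω ∈ altPow V₀ ω, ∀ F ∈ symPow V₁ f, ofTensor V₀ V₁ (Ω ⊗ₜ[ℂ] F) ∈ S) :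
    tensorPart V₀ V₁ ω f ≤ S := by
  rw [tensorPart, Submodule.span_le]
  rintro _ ⟨Ω, hΩ, F, hF, rfl⟩
  exact h Ω hΩ F hF

theorem tmul_mem_tensorPart {ω f : ℕ} {Ω : Alt V₀} (hΩ : Ω ∈ altPow V₀ ω) {F : Sym V₁}
    (hF : F ∈ symPow V₁ f) : ofTensor V₀ V₁ (Ω ⊗ₜ[ℂ] F) ∈ tensorPart V₀ V₁ ω f :=
  Submodule.subset_span ⟨Ω, hΩ, F, hF, rfl⟩

theorem degree_le {n : ℕ} {S : Submodule ℂ (SuperExt V₀ V₁)}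
    (h : ∀ ω f, ω + f = n → ∀ Ω ∈ altPow V₀ ω, ∀ F ∈ symPow V₁ f,
      ofTensor V₀ V₁ (Ω ⊗ₜ[ℂ] F) ∈ S) : degree V₀ V₁ n ≤ S :=
  iSup_le fun ω => iSup_le fun f => iSup_le fun hn => tensorPart_le (h ω f hn)

theorem tensorPart_le_degree {n ω f : ℕ} (hn : ω + f = n) :
    tensorPart V₀ V₁ ω f ≤ degree V₀ V₁ n :=
  le_iSup_of_le ω (le_iSup_of_le f (le_iSup_of_le hn le_rfl))

theorem tensorPart_le_bidegree {n ω f : ℕ} {x : ZMod 2} (hn : ω + f = n) (hx : (f : ZMod 2) = x) :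
    tensorPart V₀ V₁ ω f ≤ bidegree V₀ V₁ n x :=
  le_iSup_of_le ω (le_iSup_of_le f (le_iSup_of_le ⟨hn, hx⟩ le_rfl))

theorem bidegree_le_degree (n : ℕ) (x : ZMod 2) : bidegree V₀ V₁ n x ≤ degree V₀ V₁ n :=
  iSup_le fun _ => iSup_le fun _ => iSup_le fun hn => tensorPart_le_degree hn.1

theorem tmul_mem_degree {n ω f : ℕ} (hn : ω + f = n) {Ω : Alt V₀} (hΩ : Ω ∈ altPow V₀ ω)
    {F : Sym V₁} (hF : F ∈ symPow V₁ f) : ofTensor V₀ V₁ (Ω ⊗ₜ[ℂ] F) ∈ degree V₀ V₁ n :=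
  tensorPart_le_degree hn (tmul_mem_tensorPart hΩ hF)

theorem paritySign_of_mem_bidegree {n : ℕ} {x : ZMod 2} {A : SuperExt V₀ V₁}
    (hA : A ∈ bidegree V₀ V₁ n x) : paritySign V₀ V₁ A = sgn 1 x • A := by
  suffices h : bidegree V₀ V₁ n x ≤
      LinearMap.eqLocus (paritySign V₀ V₁) (sgn 1 x • LinearMap.id) from h hA
  refine iSup_le fun ω => iSup_le fun f => iSup_le fun hn => tensorPart_le fun Ω _ F hF => ?_
  have hs : (-1 : ℂ) ^ f = sgn 1 x := by
    rw [← hn.2, sgn, ZMod.val_one, one_mul, ZMod.val_natCast, ← neg_one_pow_eq_pow_mod_two]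
  rw [LinearMap.mem_eqLocus, paritySign_tmul, symSign_of_mem hF, TensorProduct.tmul_smul, map_smul,
    hs]
  rfl

theorem totalSign_of_mem_degree {n : ℕ} {A : SuperExt V₀ V₁} (hA : A ∈ degree V₀ V₁ n) :
    totalSign V₀ V₁ A = (-1 : ℂ) ^ n • A := by
  suffices h : degree V₀ V₁ n ≤
      LinearMap.eqLocus (totalSign V₀ V₁) ((-1 : ℂ) ^ n • LinearMap.id) from h hA
  refine degree_le fun ω f hn Ω hΩ F hF => ?_
  rw [LinearMap.mem_eqLocus, totalSign_tmul, symSign_of_mem hF, altSign_of_mem hΩ,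
    TensorProduct.tmul_smul, ← TensorProduct.smul_tmul', map_smul, map_smul, smul_smul, ← pow_add,
    add_comm, hn]
  rfl

theorem evenSign_mem {n : ℕ} {A : SuperExt V₀ V₁} (hA : A ∈ degree V₀ V₁ n) :
    evenSign V₀ V₁ A ∈ degree V₀ V₁ n := by
  suffices h : degree V₀ V₁ n ≤ (degree V₀ V₁ n).comap (evenSign V₀ V₁) from h hA
  refine degree_le fun ω f hn Ω hΩ F hF => ?_
  rw [Submodule.mem_comap, evenSign_tmul]
  refine tmul_mem_degree hn ?_ hF
  rw [altSign_of_mem hΩ]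
  exact Submodule.smul_mem _ _ hΩ

theorem totalSign_mem {n : ℕ} {A : SuperExt V₀ V₁} (hA : A ∈ degree V₀ V₁ n) :
    totalSign V₀ V₁ A ∈ degree V₀ V₁ n := by
  rw [totalSign_of_mem_degree hA]
  exact Submodule.smul_mem _ _ hA

theorem evenInterior_mem (X : V₀) {n : ℕ} {A : SuperExt V₀ V₁} (hA : A ∈ degree V₀ V₁ (n + 1)) :
    evenInterior X A ∈ degree V₀ V₁ n := by
  suffices h : degree V₀ V₁ (n + 1) ≤ (degree V₀ V₁ n).comap (evenInterior X) from h hA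
  refine degree_le fun ω f hn Ω hΩ F hF => ?_
  rw [Submodule.mem_comap, evenInterior_tmul]
  cases ω with
  | zero => rw [altInterior_zero_of_mem X hΩ, TensorProduct.zero_tmul, map_zero]; exact zero_mem _
  | succ k => exact tmul_mem_degree (by omega) (altInterior_mem_succ X hΩ) hF

theorem oddDeriv_mem (Y : V₁) {n : ℕ} {A : SuperExt V₀ V₁} (hA : A ∈ degree V₀ V₁ (n + 1)) :
    oddDeriv Y A ∈ degree V₀ V₁ n := by
  suffices h : degree V₀ V₁ (n + 1) ≤ (degree V₀ V₁ n).comap (oddDeriv Y) from h hA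
  refine degree_le fun ω f hn Ω hΩ F hF => ?_
  rw [Submodule.mem_comap, oddDeriv_tmul]
  cases f with
  | zero => rw [symDeriv_zero_of_mem Y hF, TensorProduct.tmul_zero, map_zero]; exact zero_mem _
  | succ k => exact tmul_mem_degree (by omega) hΩ (symDeriv_mem_succ Y hF)

theorem contr_mem (v : V₀ × V₁) {n : ℕ} {A : SuperExt V₀ V₁} (hA : A ∈ degree V₀ V₁ (n + 1)) :
    contr V₀ V₁ v A ∈ degree V₀ V₁ n := by
  rw [contr_eq]
  exact sub_mem (evenInterior_mem _ hA) (oddDeriv_mem _ (totalSign_mem hA))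

theorem mul_mem_degree {n m : ℕ} {A A' : SuperExt V₀ V₁} (hA : A ∈ degree V₀ V₁ n)
    (hA' : A' ∈ degree V₀ V₁ m) : A * A' ∈ degree V₀ V₁ (n + m) := by
  suffices h : degree V₀ V₁ n ≤ (degree V₀ V₁ (n + m)).comap (LinearMap.mulRight ℂ A') from h hA
  refine degree_le fun ω f hn Ω hΩ F hF => ?_
  rw [Submodule.mem_comap, LinearMap.mulRight_apply]
  suffices h : degree V₀ V₁ m ≤ (degree V₀ V₁ (n + m)).comap
      (LinearMap.mulLeft ℂ (ofTensor V₀ V₁ (Ω ⊗ₜ[ℂ] F))) from h hA'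
  refine degree_le fun ω' f' hm Ω' hΩ' F' hF' => ?_
  rw [Submodule.mem_comap, LinearMap.mulLeft_apply, tmul_mul_tmul _ hF, altSign_pow_of_mem f hΩ',
    mul_smul_comm, ← TensorProduct.smul_tmul', map_smul]
  exact Submodule.smul_mem _ _ (tmul_mem_degree (by omega) (SetLike.mul_mem_graded hΩ hΩ')
    (SetLike.mul_mem_graded hF hF'))

theorem poisson_mem (b : AdaptedBasis B) {n m : ℕ} {A A' : SuperExt V₀ V₁}
    (hA : A ∈ degree V₀ V₁ (n + 1)) (hA' : A' ∈ degree V₀ V₁ (m + 1)) :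
    poisson b A A' ∈ degree V₀ V₁ (n + m) := by
  rw [poisson_eq]
  refine add_mem (sum_mem fun j _ => neg_mem (mul_mem_degree (evenInterior_mem _
    (totalSign_mem hA)) (evenInterior_mem _ hA'))) (sum_mem fun i _ => sub_mem ?_ ?_) <;>
  exact mul_mem_degree (oddDeriv_mem _ hA) (evenSign_mem (oddDeriv_mem _ hA'))

theorem scalarPart_tmul (Ω : Alt V₀) (F : Sym V₁) :
    scalarPart V₀ V₁ (ofTensor V₀ V₁ (Ω ⊗ₜ[ℂ] F)) =
      ExteriorAlgebra.algebraMapInv (M := Module.Dual ℂ V₀) Ω *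
        SymmetricAlgebra.algebraMapInv (M := Module.Dual ℂ V₁) F := rfl

theorem scalarPart_one : scalarPart V₀ V₁ 1 = 1 := by
  have : (1 : SuperExt V₀ V₁) = ofTensor V₀ V₁ (1 ⊗ₜ[ℂ] 1) := rfl
  rw [this, scalarPart_tmul, map_one, map_one, mul_one]

theorem scalarPart_paritySign (A : SuperExt V₀ V₁) :
    scalarPart V₀ V₁ (paritySign V₀ V₁ A) = scalarPart V₀ V₁ A := by
  refine linearMap_ext_tmul (φ := scalarPart V₀ V₁ ∘ₗ paritySign V₀ V₁)
    (ψ := scalarPart V₀ V₁) (fun Ω F => ?_) A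
  rw [LinearMap.comp_apply, paritySign_tmul, scalarPart_tmul, scalarPart_tmul]
  congr 1
  induction F using SymmetricAlgebra.induction with
  | algebraMap r => rw [symSign_algebraMap]
  | ι p => rw [symSign_ι, map_neg, SymmetricAlgebra.algebraMapInv_ι, neg_zero]
  | mul F G hF hG => rw [symSign_mul, map_mul, map_mul, hF, hG]
  | add F G hF hG => rw [map_add, map_add, map_add, hF, hG]

theorem eq_scalarPart_smul_one {A : SuperExt V₀ V₁} (hA : A ∈ degree V₀ V₁ 0) :
    A = scalarPart V₀ V₁ A • 1 := by
  suffices h : degree V₀ V₁ 0 ≤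
      LinearMap.eqLocus LinearMap.id ((scalarPart V₀ V₁).smulRight 1) from h hA
  refine degree_le fun ω f hn Ω hΩ F hF => ?_
  obtain ⟨rfl, rfl⟩ : ω = 0 ∧ f = 0 := by omega
  have hΩ' : Ω ∈ (1 : Submodule ℂ (Alt V₀)) := by simpa using hΩ
  have hF' : F ∈ (1 : Submodule ℂ (Sym V₁)) := by simpa [symPow] using hF
  obtain ⟨r, rfl⟩ := Submodule.mem_one.mp hΩ'
  obtain ⟨s, rfl⟩ := Submodule.mem_one.mp hF'
  rw [LinearMap.mem_eqLocus, LinearMap.id_apply, LinearMap.smulRight_apply, scalarPart_tmul,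
    ExteriorAlgebra.algebraMap_leftInverse, SymmetricAlgebra.algebraMap_leftInverse,
    Algebra.algebraMap_eq_smul_one, Algebra.algebraMap_eq_smul_one, TensorProduct.tmul_smul,
    ← TensorProduct.smul_tmul', map_smul, map_smul, smul_smul, mul_comm]
  rfl

theorem evenInterior_of_mem_zero (X : V₀) {A : SuperExt V₀ V₁} (hA : A ∈ degree V₀ V₁ 0) :
    evenInterior X A = 0 := by
  have : (1 : SuperExt V₀ V₁) = ofTensor V₀ V₁ (1 ⊗ₜ[ℂ] 1) := rfl
  rw [eq_scalarPart_smul_one hA, map_smul, this, evenInterior_tmul, altInterior_one,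
    TensorProduct.zero_tmul, map_zero, smul_zero]

theorem oddDeriv_of_mem_zero (Y : V₁) {A : SuperExt V₀ V₁} (hA : A ∈ degree V₀ V₁ 0) :
    oddDeriv Y A = 0 := by
  have : (1 : SuperExt V₀ V₁) = ofTensor V₀ V₁ (1 ⊗ₜ[ℂ] 1) := rfl
  rw [eq_scalarPart_smul_one hA, map_smul, this, oddDeriv_tmul, Derivation.map_one_eq_zero,
    TensorProduct.tmul_zero, map_zero, smul_zero]

/-- A threefold contraction of I is a constant; this discards its brackets when {I, I} is contracted
four times. -/
theorem poisson_of_mem_zero_left (b : AdaptedBasis B) {A : SuperExt V₀ V₁}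
    (hA : A ∈ degree V₀ V₁ 0) (A' : SuperExt V₀ V₁) : poisson b A A' = 0 := by
  simp [poisson_eq, evenInterior_of_mem_zero _ (totalSign_mem hA), oddDeriv_of_mem_zero _ hA]

theorem poisson_of_mem_zero_right (b : AdaptedBasis B) (A : SuperExt V₀ V₁) {A' : SuperExt V₀ V₁}
    (hA' : A' ∈ degree V₀ V₁ 0) : poisson b A A' = 0 := by
  simp [poisson_eq, evenInterior_of_mem_zero _ hA', oddDeriv_of_mem_zero _ hA']

/-- Euler's formula: a form of positive degree all of whose contractions vanish is zero. -/
theorem eq_zero_of_contr_eq_zero [FiniteDimensional ℂ V₀] [FiniteDimensional ℂ V₁] {n : ℕ}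
    {A : SuperExt V₀ V₁} (hA : A ∈ degree V₀ V₁ (n + 1)) (h0 : ∀ X : V₀, evenInterior X A = 0)
    (h1 : ∀ Y : V₁, oddDeriv Y A = 0) : A = 0 := by
  let e := Module.finBasis ℂ V₀
  let e' := Module.finBasis ℂ V₁
  -- L is the Euler operator: it multiplies Alt^ω ⊗ Sym^f by ω + f = n + 1, which is invertible in
  -- ℂ, while it kills A because every contraction of A vanishes.
  let L : SuperExt V₀ V₁ →ₗ[ℂ] SuperExt V₀ V₁ :=
    ∑ j, mapTensor V₀ V₁ (LinearMap.mulLeft ℂ (ExteriorAlgebra.ι ℂ (e.coord j))) LinearMap.id ∘ₗ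
      evenInterior (e j) +
    ∑ j, mapTensor V₀ V₁ LinearMap.id
      (LinearMap.mulLeft ℂ (SymmetricAlgebra.ι ℂ _ (e'.coord j))) ∘ₗ oddDeriv (e' j)
  have hL : L A = ((n + 1 : ℕ) : ℂ) • A := by
    suffices h : degree V₀ V₁ (n + 1) ≤
        LinearMap.eqLocus L (((n + 1 : ℕ) : ℂ) • LinearMap.id) from h hA
    refine degree_le fun ω f hn Ω hΩ F hF => ?_
    simp only [LinearMap.mem_eqLocus, L, LinearMap.add_apply, LinearMap.sum_apply,
      LinearMap.comp_apply, evenInterior_tmul, oddDeriv_tmul, mapTensor_tmul, LinearMap.id_apply,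
      LinearMap.mulLeft_apply, LinearMap.smul_apply]
    rw [← map_sum, ← map_sum, ← TensorProduct.sum_tmul, ← TensorProduct.tmul_sum,
      alt_euler e hΩ, sym_euler e' hF, TensorProduct.tmul_smul, ← TensorProduct.smul_tmul',
      map_smul, map_smul, ← add_smul, ← hn]
    push_cast
    rfl
  have hL0 : L A = 0 := by
    simp [L, h0, h1]
  rw [hL0] at hL
  exact (smul_eq_zero.mp hL.symm).resolve_left (Nat.cast_ne_zero.mpr n.succ_ne_zero)

/-- A form of degree `n` is determined by its values on homogeneous vectors. -/
theorem eq_zero_of_eval_eq_zero [FiniteDimensional ℂ V₀] [FiniteDimensional ℂ V₁] :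
    ∀ (n : ℕ) {A : SuperExt V₀ V₁}, A ∈ degree V₀ V₁ n →
      (∀ v : Fin n → V₀ × V₁, (∀ i, ∃ x, v i ∈ part V₀ V₁ x) → eval n v A = 0) → A = 0
  | 0, A, hA, h => by
    rw [eq_scalarPart_smul_one hA]
    have : scalarPart V₀ V₁ A = 0 := h 0 (fun i => i.elim0)
    rw [this, zero_smul]
  | n + 1, A, hA, h => by
    have key : ∀ w : V₀ × V₁, (∃ x, w ∈ part V₀ V₁ x) → contr V₀ V₁ w A = 0 := by
      intro w hw
      refine eq_zero_of_eval_eq_zero n (contr_mem w hA) fun v hv => ?_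
      have := h (Fin.cons w v) (Fin.cases hw hv)
      rwa [eval_succ, Fin.cons_zero, Fin.tail_cons] at this
    refine eq_zero_of_contr_eq_zero hA (fun X => ?_) (fun Y => ?_)
    · rw [← contr_even]
      exact key _ ⟨0, even_mem_part X⟩
    · have := key _ ⟨1, odd_mem_part Y⟩
      rw [contr_odd, totalSign_of_mem_degree hA, map_smul, ← smul_neg, smul_eq_zero] at this
      simpa using this

theorem eq_of_eval_eq [FiniteDimensional ℂ V₀] [FiniteDimensional ℂ V₁] {n : ℕ}
    {A A' : SuperExt V₀ V₁} (hA : A ∈ degree V₀ V₁ n) (hA' : A' ∈ degree V₀ V₁ n)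
    (h : ∀ v, eval n v A = eval n v A') : A = A' :=
  sub_eq_zero.mp (eq_zero_of_eval_eq_zero n (sub_mem hA hA')
    fun v _ => by rw [map_sub, h, sub_self])

theorem bidegree_three_zero :
    bidegree V₀ V₁ 3 0 = tensorPart V₀ V₁ 3 0 ⊔ tensorPart V₀ V₁ 1 2 := by
  refine le_antisymm (iSup_le fun ω => iSup_le fun f => iSup_le fun hn => ?_)
    (sup_le (tensorPart_le_bidegree (by norm_num) (by norm_num))
      (tensorPart_le_bidegree (by norm_num) rfl))
  obtain ⟨hn, hf⟩ := hn
  have hf' : f % 2 = 0 := Nat.mod_eq_zero_of_dvd ((ZMod.natCast_eq_zero_iff f 2).mp hf)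
  obtain ⟨rfl, rfl⟩ | ⟨rfl, rfl⟩ : (ω = 3 ∧ f = 0) ∨ (ω = 1 ∧ f = 2) := by omega
  · exact le_sup_left
  · exact le_sup_right

/-- The projection of Alt(g₀) onto degree ω, extended to E(g), is the identity on the first space
and zero on the second. -/
theorem disjoint_tensorPart {ω ω' : ℕ} (h : ω ≠ ω') (f f' : ℕ) :
    Disjoint (tensorPart V₀ V₁ ω f) (tensorPart V₀ V₁ ω' f') := by
  let π : SuperExt V₀ V₁ →ₗ[ℂ] SuperExt V₀ V₁ :=
    mapTensor V₀ V₁ (GradedAlgebra.proj (fun i : ℕ => altPow V₀ i) ω) LinearMap.id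
  have h1 : tensorPart V₀ V₁ ω f ≤ LinearMap.eqLocus π LinearMap.id := by
    refine tensorPart_le fun Ω hΩ F _ => ?_
    rw [LinearMap.mem_eqLocus, mapTensor_tmul, GradedAlgebra.proj_apply,
      DirectSum.decompose_of_mem_same _ hΩ]
    rfl
  have h2 : tensorPart V₀ V₁ ω' f' ≤ LinearMap.ker π := by
    refine tensorPart_le fun Ω hΩ F _ => ?_
    rw [LinearMap.mem_ker, mapTensor_tmul, GradedAlgebra.proj_apply,
      DirectSum.decompose_of_mem_ne _ hΩ h.symm, TensorProduct.zero_tmul, map_zero]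
  rw [Submodule.disjoint_def]
  intro A hA hA'
  exact (h1 hA).symm.trans (h2 hA')

end Degrees

/-! ### Symmetries of the trilinear form of an element. -/

section TrilinearForms

variable {V₀ V₁ : Type*} [AddCommGroup V₀] [Module ℂ V₀] [AddCommGroup V₁] [Module ℂ V₁]
variable {B : LinearMap.BilinForm ℂ (V₀ × V₁)}

/-- Linear maps on `g` agree if they agree on homogeneous vectors. -/
theorem linearMap_ext_part {M : Type*} [AddCommGroup M] [Module ℂ M] {φ ψ : V₀ × V₁ →ₗ[ℂ] M}
    (h : ∀ x, ∀ X ∈ part V₀ V₁ x, φ X = ψ X) : φ = ψ :=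
  LinearMap.prod_ext (LinearMap.ext fun X => h 0 _ (even_mem_part X))
    (LinearMap.ext fun Y => h 1 _ (odd_mem_part Y))

variable (V₀ V₁) in
/-- The trilinear form of an element of `E(g)`. -/
def form : SuperExt V₀ V₁ →ₗ[ℂ] V₀ × V₁ →ₗ[ℂ] V₀ × V₁ →ₗ[ℂ] V₀ × V₁ →ₗ[ℂ] ℂ :=
  (contr V₀ V₁).flip.compr₂ ((contr V₀ V₁).flip.compr₂
    ((contr V₀ V₁).flip.compr₂ (scalarPart V₀ V₁)))

theorem form_apply (A : SuperExt V₀ V₁) (X Y Z : V₀ × V₁) :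
    form V₀ V₁ A X Y Z =
      scalarPart V₀ V₁ (contr V₀ V₁ Z (contr V₀ V₁ Y (contr V₀ V₁ X A))) := rfl

theorem eval_eq_form (A : SuperExt V₀ V₁) (X Y Z : V₀ × V₁) :
    eval 3 ![X, Y, Z] A = form V₀ V₁ A X Y Z := rfl

theorem form_swap_left (A : SuperExt V₀ V₁) {x y : ZMod 2} {X Y : V₀ × V₁}
    (hX : X ∈ part V₀ V₁ x) (hY : Y ∈ part V₀ V₁ y) (Z : V₀ × V₁) :
    form V₀ V₁ A X Y Z = -sgn x y * form V₀ V₁ A Y X Z := by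
  rw [form_apply, contr_comm hY hX, map_smul, map_smul, smul_eq_mul, sgn_comm y x, form_apply]

theorem form_swap_right (A : SuperExt V₀ V₁) {y z : ZMod 2} (X : V₀ × V₁) {Y Z : V₀ × V₁}
    (hY : Y ∈ part V₀ V₁ y) (hZ : Z ∈ part V₀ V₁ z) :
    form V₀ V₁ A X Y Z = -sgn y z * form V₀ V₁ A X Z Y := by
  rw [form_apply, contr_comm hZ hY, map_smul, smul_eq_mul, sgn_comm z y, form_apply]

/-- The form of an even element vanishes on homogeneous vectors whose parities add up to `1`. -/
theorem form_eq_zero {A : SuperExt V₀ V₁} (hA : paritySign V₀ V₁ A = A) {x y z : ZMod 2}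
    {X Y Z : V₀ × V₁} (hX : X ∈ part V₀ V₁ x) (hY : Y ∈ part V₀ V₁ y) (hZ : Z ∈ part V₀ V₁ z)
    (h : x + y + z = 1) : form V₀ V₁ A X Y Z = 0 := by
  -- Moving the parity operator through three contractions costs (-1)^{x+y+z}, and it fixes both A
  -- and the scalars. For odd x + y + z the value equals its own negative.
  have key : form V₀ V₁ A X Y Z = sgn 1 (x + y + z) * form V₀ V₁ A X Y Z := by
    conv_lhs => rw [form_apply, ← scalarPart_paritySign, paritySign_contr hZ, paritySign_contr hY,
      paritySign_contr hX, hA]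
    simp only [map_smul, smul_eq_mul, ← form_apply, sgn_add_right]
    ring
  rw [h, sgn_one_one, neg_one_mul] at key
  exact self_eq_neg.mp key

/-- The parity automorphism of `g`. -/
def parityMap : V₀ × V₁ →ₗ[ℂ] V₀ × V₁ :=
  LinearMap.prodMap LinearMap.id (-LinearMap.id)

theorem parityMap_parityMap (X : V₀ × V₁) : parityMap (parityMap X) = X := by
  simp [parityMap]

theorem parityMap_of_mem {x : ZMod 2} {X : V₀ × V₁} (hX : X ∈ part V₀ V₁ x) :
    parityMap X = sgn x x • X :=
  part_cases (P := fun x X => parityMap X = sgn x x • X)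
    (fun X => by simp [parityMap, sgn_zero_left]) (fun X => by simp [parityMap, sgn_one_one]) hX

/-- Cyclic symmetry of the form of an even element. -/
theorem form_cyclic {A : SuperExt V₀ V₁} (hA : paritySign V₀ V₁ A = A) (X Y Z : V₀ × V₁) :
    form V₀ V₁ A (parityMap Z) X Y = form V₀ V₁ A X Y Z := by
  -- The right side is the map (Z, X, Y) ↦ A(X, Y, Z); as an equality of trilinear maps the claim
  -- need only be checked on homogeneous vectors.
  have key : form V₀ V₁ A ∘ₗ parityMap = (LinearMap.lflip.comp (form V₀ V₁ A)).flip := by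
    refine linearMap_ext_part fun z Z hZ => linearMap_ext_part fun x X hX =>
      linearMap_ext_part fun y Y hY => ?_
    change form V₀ V₁ A (parityMap Z) X Y = form V₀ V₁ A X Y Z
    rw [parityMap_of_mem hZ, map_smul, LinearMap.smul_apply, LinearMap.smul_apply, smul_eq_mul]
    -- If the parities add up to 0 then z = x + y, and moving Z past X and Y costs (-1)^{zx+zy} =
    -- (-1)^{zz}, exactly the sign of `parityMap`. Otherwise both sides vanish.
    rcases zmod_two_cases (x + y + z) with h | h
    · rw [form_swap_left A hZ hX, form_swap_right A X hZ hY]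
      have hz : z = x + y := by
        have h2 : ∀ x y z : ZMod 2, x + y + z = 0 → z = x + y := by decide
        exact h2 x y z h
      have : sgn z z = sgn z x * sgn z y := by rw [← sgn_add_right, ← hz]
      rw [this]
      linear_combination form V₀ V₁ A X Y Z * (sgn z y * sgn z y * sgn_mul_self z x +
        sgn_mul_self z y)
    · rw [form_eq_zero hA hX hY hZ h, form_eq_zero hA hZ hX hY (by rw [← h]; ring), mul_zero]
  exact congrArg (fun T : V₀ × V₁ →ₗ[ℂ] V₀ × V₁ →ₗ[ℂ] V₀ × V₁ →ₗ[ℂ] ℂ => T Z X Y) key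

end TrilinearForms

/-! ### The bilinear form in an adapted basis, and brackets of linear forms. -/

section QuadraticSpace

variable {V₀ V₁ : Type*} [AddCommGroup V₀] [Module ℂ V₀] [AddCommGroup V₁] [Module ℂ V₁]
variable {B : LinearMap.BilinForm ℂ (V₀ × V₁)}

theorem IsQuadraticSpace.eq_zero (hB : IsQuadraticSpace B) {U : V₀ × V₁} (h : ∀ W, B U W = 0) :
    U = 0 :=
  hB.nondegenerate.1 U h

theorem IsQuadraticSpace.even_odd (hB : IsQuadraticSpace B) (X : V₀) (Y : V₁) :
    B (X, 0) (0, Y) = 0 :=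
  hB.even _ (even_mem_part X) _ (odd_mem_part Y)

theorem IsQuadraticSpace.odd_even (hB : IsQuadraticSpace B) (X : V₀) (Y : V₁) :
    B (0, Y) (X, 0) = 0 := by
  rw [hB.supersymm 1 0 _ (odd_mem_part Y) _ (even_mem_part X), hB.even_odd, mul_zero]

theorem IsQuadraticSpace.odd_symm (hB : IsQuadraticSpace B) (Y Y' : V₁) :
    B (0, Y) (0, Y') = -B (0, Y') (0, Y) := by
  rw [hB.supersymm 1 1 _ (odd_mem_part Y) _ (odd_mem_part Y'), sgn_one_one, neg_one_mul]

theorem IsQuadraticSpace.even_symm (hB : IsQuadraticSpace B) (X X' : V₀) :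
    B (X, 0) (X', 0) = B (X', 0) (X, 0) := by
  rw [hB.supersymm 0 0 _ (even_mem_part X) _ (even_mem_part X'), sgn_zero_left, one_mul]

/-- Supersymmetry of B for arbitrary vectors: the parity automorphism absorbs the sign on the odd
part. -/
theorem IsQuadraticSpace.parity_symm (hB : IsQuadraticSpace B) (U W : V₀ × V₁) :
    B U (parityMap W) = B W U := by
  obtain ⟨U0, U1⟩ := U
  obtain ⟨W0, W1⟩ := W
  have hU : ((U0, U1) : V₀ × V₁) = (U0, 0) + (0, U1) := by simp
  have hW : ((W0, W1) : V₀ × V₁) = (W0, 0) + (0, W1) := by simp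
  have hW' : (parityMap (W0, W1) : V₀ × V₁) = (W0, 0) - (0, W1) := by simp [parityMap]
  rw [hW', hU, hW]
  simp only [map_add, map_sub, LinearMap.add_apply, hB.even_odd, hB.odd_even, hB.even_symm U0,
    hB.odd_symm U1]
  ring

/-- The expansion of a vector in an adapted basis. -/
theorem AdaptedBasis.expand (hB : IsQuadraticSpace B) (b : AdaptedBasis B) (V : V₀ × V₁) :
    V = ∑ j, B V (b.even j, 0) • ((b.even j, 0) : V₀ × V₁) +
      ∑ i, (B V (0, b.odd (.inr i)) • ((0, b.odd (.inl i)) : V₀ × V₁) -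
        B V (0, b.odd (.inl i)) • ((0, b.odd (.inr i)) : V₀ × V₁)) := by
  have key : LinearMap.id = ∑ j, (B.flip (b.even j, 0)).smulRight ((b.even j, 0) : V₀ × V₁) +
      ∑ i, ((B.flip (0, b.odd (.inr i))).smulRight ((0, b.odd (.inl i)) : V₀ × V₁) -
        (B.flip (0, b.odd (.inl i))).smulRight ((0, b.odd (.inr i)) : V₀ × V₁)) := by
    -- Checked on basis vectors. The coefficient of Yᵢ is -B(V, Xᵢ) since B(Yᵢ, Xᵢ) = -1.
    refine LinearMap.prod_ext (b.even.ext fun k => ?_) (b.odd.ext fun k => ?_)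
    · simp [LinearMap.sum_apply, b.orthonormal, hB.even_odd, ite_smul]
    · rcases k with k | k
      · simp [LinearMap.sum_apply, b.darboux_inl, b.darboux, hB.odd_even, ite_smul]
      · simp [LinearMap.sum_apply, b.darboux_inr, b.darboux, hB.odd_even, ite_smul,
          hB.odd_symm (b.odd (.inr k))]
  have := congrArg (fun L : V₀ × V₁ →ₗ[ℂ] V₀ × V₁ => L V) key
  simpa only [LinearMap.sum_apply, LinearMap.add_apply, LinearMap.sub_apply, LinearMap.id_apply,
    LinearMap.smulRight_apply, LinearMap.BilinForm.flip_apply] using this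

/-- The bracket of two linear forms is given by the bilinear form. -/
theorem poisson_of_mem_one (hB : IsQuadraticSpace B) (b : AdaptedBasis B) {α β : SuperExt V₀ V₁}
    (hα : α ∈ degree V₀ V₁ 1) (hβ : β ∈ degree V₀ V₁ 1) {U V : V₀ × V₁}
    (hU : ∀ W, scalarPart V₀ V₁ (contr V₀ V₁ W α) = B U W)
    (hV : ∀ W, scalarPart V₀ V₁ (contr V₀ V₁ W β) = B V W) :
    poisson b α β = B U V • 1 := by
  have even : ∀ {γ : SuperExt V₀ V₁} {T : V₀ × V₁}, γ ∈ degree V₀ V₁ 1 →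
      (∀ W, scalarPart V₀ V₁ (contr V₀ V₁ W γ) = B T W) →
      ∀ X, evenInterior X γ = B T (X, 0) • 1 := by
    intro γ T hγ hT X
    rw [← contr_even, eq_scalarPart_smul_one (contr_mem _ hγ), hT]
  have odd : ∀ {γ : SuperExt V₀ V₁} {T : V₀ × V₁}, γ ∈ degree V₀ V₁ 1 →
      (∀ W, scalarPart V₀ V₁ (contr V₀ V₁ W γ) = B T W) →
      ∀ Y, oddDeriv Y γ = B T (0, Y) • 1 := by
    intro γ T hγ hT Y
    have h := contr_odd Y γ
    rw [totalSign_of_mem_degree hγ, pow_one, neg_one_smul, map_neg, neg_neg] at h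
    rw [← h, eq_scalarPart_smul_one (contr_mem _ hγ), hT]
  have hone : evenSign V₀ V₁ (1 : SuperExt V₀ V₁) = 1 := by
    have : (1 : SuperExt V₀ V₁) = ofTensor V₀ V₁ (1 ⊗ₜ[ℂ] 1) := rfl
    rw [this, evenSign_tmul, altSign_one]
  rw [poisson_eq, totalSign_of_mem_degree hα, pow_one, neg_one_smul]
  simp only [map_smul, map_neg, even hα hU, even hβ hV, odd hα hU, odd hβ hV, hone, smul_mul_assoc, one_mul,
    smul_smul, neg_mul, neg_neg, ← sub_smul, ← Finset.sum_smul, ← add_smul]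
  congr 1
  -- The contractions of α and β are the constants B(U, ·) and B(V, ·) at the basis vectors, so {α,
  -- β} is the pairing of U with the expansion of V.
  conv_rhs => rw [b.expand hB V]
  simp only [map_add, map_sum, map_sub, map_smul, smul_eq_mul]
  congr 1 <;> refine Finset.sum_congr rfl fun j _ => by ring

end QuadraticSpace

/-! ### The correspondence between bilinear maps and the operators D_F. -/

section Differentials

variable {V₀ V₁ : Type*} [AddCommGroup V₀] [Module ℂ V₀] [AddCommGroup V₁] [Module ℂ V₁]

theorem superD_tmul (Ω : SuperExt V₀ V₁) (X : V₀ × V₁) (A : SuperExt V₀ V₁) :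
    superD (Ω ⊗ₜ[ℂ] X) A =
      -(Ω * evenInterior X.1 A + paritySign V₀ V₁ Ω * oddInterior X.2 A) := rfl

theorem toBilin_tmul (Ω : SuperExt V₀ V₁) (X Y Z : V₀ × V₁) :
    toBilin (Ω ⊗ₜ[ℂ] X) Y Z = eval 2 ![Y, Z] Ω • X := rfl

/-- The contraction of an element of `M ⊗ g` with a linear form on `g`. -/
def tensorContr (M : Type*) [AddCommGroup M] [Module ℂ M] (φ : Module.Dual ℂ (V₀ × V₁)) :
    M ⊗[ℂ] (V₀ × V₁) →ₗ[ℂ] M :=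
  (TensorProduct.rid ℂ M).toLinearMap ∘ₗ LinearMap.lTensor M φ

theorem tensorContr_tmul (M : Type*) [AddCommGroup M] [Module ℂ M]
    (φ : Module.Dual ℂ (V₀ × V₁)) (m : M) (X : V₀ × V₁) :
    tensorContr M φ (m ⊗ₜ[ℂ] X) = φ X • m := rfl

/-- The inclusion of `E^2(g) ⊗ g` in `E(g) ⊗ g`. -/
abbrev inclTensor (t : degree V₀ V₁ 2 ⊗[ℂ] (V₀ × V₁)) : SuperExt V₀ V₁ ⊗[ℂ] (V₀ × V₁) :=
  LinearMap.rTensor (V₀ × V₁) (degree V₀ V₁ 2).subtype t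

theorem tensorContr_inclTensor (φ : Module.Dual ℂ (V₀ × V₁))
    (t : degree V₀ V₁ 2 ⊗[ℂ] (V₀ × V₁)) :
    tensorContr (SuperExt V₀ V₁) φ (inclTensor t) = (tensorContr (degree V₀ V₁ 2) φ t : _) := by
  induction t using TensorProduct.induction_on with
  | zero => simp
  | tmul m X => rfl
  | add s t hs ht => simp only [inclTensor, map_add, Submodule.coe_add] at hs ht ⊢; rw [hs, ht]

theorem eval_tensorContr (φ : Module.Dual ℂ (V₀ × V₁)) (t : SuperExt V₀ V₁ ⊗[ℂ] (V₀ × V₁))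
    (Y Z : V₀ × V₁) :
    eval 2 ![Y, Z] (tensorContr _ φ t) = φ (toBilin t Y Z) := by
  induction t using TensorProduct.induction_on with
  | zero => simp [toBilin]
  | tmul m X => rw [tensorContr_tmul, toBilin_tmul, map_smul, map_smul, smul_eq_mul, smul_eq_mul,
      mul_comm]
  | add s t hs ht =>
    have : toBilin (s + t) Y Z = toBilin s Y Z + toBilin t Y Z := by simp [toBilin]
    rw [map_add, map_add, this, map_add, hs, ht]

/-- On linear forms, contraction gives constants, so D_F returns the components of F. Together with
`superD_odd` this recovers F from D_F. -/
theorem superD_even (t : SuperExt V₀ V₁ ⊗[ℂ] (V₀ × V₁)) (α : Module.Dual ℂ V₀) :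
    superD t (ofTensor V₀ V₁ (ExteriorAlgebra.ι ℂ α ⊗ₜ[ℂ] 1)) =
      -tensorContr _ (α ∘ₗ LinearMap.fst ℂ V₀ V₁) t := by
  have hone : ofTensor V₀ V₁ (1 ⊗ₜ[ℂ] 1) = 1 := rfl
  induction t using TensorProduct.induction_on with
  | zero => simp
  | tmul m X =>
    rw [superD_tmul, tensorContr_tmul, evenInterior_tmul, oddInterior_tmul, altInterior_ι,
      Derivation.map_one_eq_zero, TensorProduct.tmul_zero, map_zero, neg_zero, mul_zero, add_zero,
      Algebra.algebraMap_eq_smul_one, ← TensorProduct.smul_tmul', map_smul, hone, mul_smul_comm,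
      mul_one]
    rfl
  | add s t hs ht => rw [map_add, map_add, LinearMap.add_apply, hs, ht, neg_add]

theorem superD_odd (t : SuperExt V₀ V₁ ⊗[ℂ] (V₀ × V₁)) (p : Module.Dual ℂ V₁) :
    superD t (ofTensor V₀ V₁ (1 ⊗ₜ[ℂ] SymmetricAlgebra.ι ℂ _ p)) =
      paritySign V₀ V₁ (tensorContr _ (p ∘ₗ LinearMap.snd ℂ V₀ V₁) t) := by
  have hone : ofTensor V₀ V₁ (1 ⊗ₜ[ℂ] 1) = 1 := rfl
  induction t using TensorProduct.induction_on with
  | zero => simp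
  | tmul m X =>
    rw [superD_tmul, tensorContr_tmul, evenInterior_tmul, oddInterior_tmul, altInterior_one,
      TensorProduct.zero_tmul, map_zero, mul_zero, zero_add, symDeriv_ι, altSign_one,
      Algebra.algebraMap_eq_smul_one, TensorProduct.tmul_smul, map_smul, hone, mul_neg, neg_neg,
      mul_smul_comm, mul_one, map_smul]
    rfl
  | add s t hs ht => rw [map_add, map_add, LinearMap.add_apply, hs, ht, map_add]

/-- An element of `M ⊗ g` is determined by its contractions. -/
theorem eq_of_tensorContr_eq [FiniteDimensional ℂ V₀] [FiniteDimensional ℂ V₁] {M : Type*}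
    [AddCommGroup M] [Module ℂ M] {t t' : M ⊗[ℂ] (V₀ × V₁)}
    (h : ∀ φ, tensorContr M φ t = tensorContr M φ t') : t = t' := by
  let e := Module.finBasis ℂ (V₀ × V₁)
  have key : ∀ t : M ⊗[ℂ] (V₀ × V₁), ∑ i, tensorContr M (e.coord i) t ⊗ₜ[ℂ] e i = t := by
    intro t
    induction t using TensorProduct.induction_on with
    | zero => simp
    | tmul m X =>
      simp only [tensorContr_tmul, TensorProduct.smul_tmul, ← TensorProduct.tmul_sum,
        Module.Basis.coord_apply, e.sum_repr]
    | add s t hs ht => simp only [map_add, TensorProduct.add_tmul, Finset.sum_add_distrib, hs, ht]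
  rw [← key t, ← key t']
  simp only [h]

/-- The operator `D_F` is determined by `F`. -/
theorem IsDifferential.unique_operator [FiniteDimensional ℂ V₀] [FiniteDimensional ℂ V₁]
    {F : V₀ × V₁ →ₗ[ℂ] V₀ × V₁ →ₗ[ℂ] V₀ × V₁} {d d' : SuperExt V₀ V₁ →ₗ[ℂ] SuperExt V₀ V₁}
    (h : IsDifferential F d) (h' : IsDifferential F d') : d = d' := by
  obtain ⟨t, ht, rfl⟩ := h
  obtain ⟨t', ht', rfl⟩ := h'
  -- Each component of t is a form in E^2 whose values are those of a component of F; hence F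
  -- determines t, not merely its operator.
  have : t = t' := by
    refine eq_of_tensorContr_eq fun φ => Subtype.ext ?_
    refine eq_of_eval_eq (Subtype.prop _) (Subtype.prop _) fun v => ?_
    rw [← tensorContr_inclTensor, ← tensorContr_inclTensor]
    have hv : v = ![v 0, v 1] := by ext i <;> fin_cases i <;> rfl
    rw [hv, eval_tensorContr, eval_tensorContr, ht, ht']
  rw [this]

/-- The bilinear map `F` is determined by the operator `D_F`. -/
theorem IsDifferential.unique_bracket
    {F G : V₀ × V₁ →ₗ[ℂ] V₀ × V₁ →ₗ[ℂ] V₀ × V₁} {d : SuperExt V₀ V₁ →ₗ[ℂ] SuperExt V₀ V₁}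
    (h : IsDifferential F d) (h' : IsDifferential G d) : F = G := by
  obtain ⟨t, ht, rfl⟩ := h
  obtain ⟨t', ht', h⟩ := h'
  have h0 : ∀ α : Module.Dual ℂ V₀,
      tensorContr _ (α ∘ₗ LinearMap.fst ℂ V₀ V₁) (inclTensor t) =
        tensorContr _ (α ∘ₗ LinearMap.fst ℂ V₀ V₁) (inclTensor t') := by
    intro α
    rw [← neg_inj, ← superD_even, ← superD_even, h]
  have h1 : ∀ p : Module.Dual ℂ V₁,
      tensorContr _ (p ∘ₗ LinearMap.snd ℂ V₀ V₁) (inclTensor t) =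
        tensorContr _ (p ∘ₗ LinearMap.snd ℂ V₀ V₁) (inclTensor t') := by
    intro p
    rw [← paritySign_paritySign (tensorContr _ _ (inclTensor t)), ← superD_odd, ← h, superD_odd,
      paritySign_paritySign]
  refine LinearMap.ext₂ fun Y Z => Prod.ext ?_ ?_
  · refine (Module.forall_dual_apply_eq_zero_iff ℂ _).mp (fun α => ?_) |> sub_eq_zero.mp
    have := congrArg (eval 2 ![Y, Z]) (h0 α)
    rw [eval_tensorContr, eval_tensorContr, ht, ht'] at this
    rw [map_sub, sub_eq_zero]
    exact this
  · refine (Module.forall_dual_apply_eq_zero_iff ℂ _).mp (fun α => ?_) |> sub_eq_zero.mp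
    have := congrArg (eval 2 ![Y, Z]) (h1 α)
    rw [eval_tensorContr, eval_tensorContr, ht, ht'] at this
    rw [map_sub, sub_eq_zero]
    exact this

end Differentials

/-! ### The bracket built from a cubic form. -/

section Bracket

variable {V₀ V₁ : Type*} [AddCommGroup V₀] [Module ℂ V₀] [AddCommGroup V₁] [Module ℂ V₁]
variable {B : LinearMap.BilinForm ℂ (V₀ × V₁)}

/-- The bilinear map `(Y, Z) ↦ I(W, Y, Z) U`. -/
def formSmul (I : SuperExt V₀ V₁) (W U : V₀ × V₁) : V₀ × V₁ →ₗ[ℂ] V₀ × V₁ →ₗ[ℂ] V₀ × V₁ :=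
  (form V₀ V₁ I W).compr₂ (LinearMap.toSpanSingleton ℂ _ U)

theorem formSmul_apply (I : SuperExt V₀ V₁) (W U Y Z : V₀ × V₁) :
    formSmul I W U Y Z = form V₀ V₁ I W Y Z • U := rfl

/-- The bilinear map `F` with `D_F = -ad_P(I)`. -/
def bracketOf (b : AdaptedBasis B) (I : SuperExt V₀ V₁) :
    V₀ × V₁ →ₗ[ℂ] V₀ × V₁ →ₗ[ℂ] V₀ × V₁ :=
  ∑ j, formSmul I (b.even j, 0) (b.even j, 0) +
    ∑ i, (formSmul I (0, b.odd (.inl i)) (0, b.odd (.inr i)) -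
      formSmul I (0, b.odd (.inr i)) (0, b.odd (.inl i)))

/-- By `poisson_eq`, ad_P(I) is a sum of terms (contraction of I) ∧ (contraction), so the tensor can
be read off. The signs agree because I has odd degree and even parity. -/
theorem isDifferential_bracketOf (b : AdaptedBasis B) {I : SuperExt V₀ V₁}
    (hI : I ∈ degree V₀ V₁ 3) (hp : paritySign V₀ V₁ I = I) :
    IsDifferential (bracketOf b I) (-poisson b I) := by
  let c : V₀ × V₁ → degree V₀ V₁ 2 := fun W => ⟨contr V₀ V₁ W I, contr_mem W hI⟩
  let t : degree V₀ V₁ 2 ⊗[ℂ] (V₀ × V₁) :=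
    ∑ j, c (b.even j, 0) ⊗ₜ[ℂ] (b.even j, 0) +
    ∑ i, (c (0, b.odd (.inl i)) ⊗ₜ[ℂ] (0, b.odd (.inr i)) -
      c (0, b.odd (.inr i)) ⊗ₜ[ℂ] (0, b.odd (.inl i)))
  have ht : inclTensor t = ∑ j, contr V₀ V₁ (b.even j, 0) I ⊗ₜ[ℂ] (b.even j, 0) +
    ∑ i, (contr V₀ V₁ (0, b.odd (.inl i)) I ⊗ₜ[ℂ] (0, b.odd (.inr i)) -
      contr V₀ V₁ (0, b.odd (.inr i)) I ⊗ₜ[ℂ] (0, b.odd (.inl i))) := by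
    simp only [inclTensor, t, map_add, map_sum, map_sub, LinearMap.rTensor_tmul,
      Submodule.subtype_apply, c]
  refine ⟨t, fun Y Z => ?_, ?_⟩
  · change toBilin (inclTensor t) Y Z = _
    rw [ht]
    simp only [toBilin, map_add, map_sum, map_sub, LinearMap.rTensor_tmul, TensorProduct.lid_tmul,
      bracketOf, LinearMap.add_apply, LinearMap.sub_apply, LinearMap.sum_apply, formSmul_apply]
    rfl
  · change superD (inclTensor t) = _
    rw [ht]
    refine LinearMap.ext fun A => ?_
    have hs : totalSign V₀ V₁ I = -I := by
      rw [totalSign_of_mem_degree hI]; norm_num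
    have hodd : ∀ Y, contr V₀ V₁ (0, Y) I = oddDeriv Y I := fun Y => by
      rw [contr_odd, hs, map_neg, neg_neg]
    have hpar : ∀ Y, paritySign V₀ V₁ (oddDeriv Y I) = -oddDeriv Y I := fun Y => by
      conv_rhs => rw [← hp, oddDeriv_paritySign, neg_neg]
    rw [LinearMap.neg_apply, poisson_eq, hs, neg_add, ← Finset.sum_neg_distrib,
      ← Finset.sum_neg_distrib]
    simp only [map_add, map_sum, map_sub, LinearMap.add_apply, LinearMap.sub_apply,
      LinearMap.sum_apply, superD_tmul, contr_even, hodd, hpar, oddInterior_eq, oddDeriv_zero,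
      evenInterior_zero, map_zero, neg_zero, mul_zero, add_zero, zero_add, map_neg, neg_mul,
      mul_neg, neg_neg, neg_sub, sub_neg_eq_add]
    congr 1
    refine Finset.sum_congr rfl fun i _ => ?_
    abel

/-- Cyclic symmetry moves Z, up to parity, to the first slot of I; expanding it there in the adapted
basis produces the terms that define the bracket. -/
theorem bracketOf_spec (hB : IsQuadraticSpace B) (b : AdaptedBasis B) {I : SuperExt V₀ V₁}
    (hp : paritySign V₀ V₁ I = I) (X Y Z : V₀ × V₁) :
    B (bracketOf b I X Y) Z = form V₀ V₁ I X Y Z := by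
  have hsymm : ∀ U, B U Z = B (parityMap Z) U := fun U => by
    rw [← hB.parity_symm U, parityMap_parityMap]
  rw [← form_cyclic hp]
  conv_rhs => rw [b.expand hB (parityMap Z)]
  simp only [bracketOf, map_add, map_sum, map_sub, LinearMap.add_apply, LinearMap.sub_apply,
    LinearMap.sum_apply, formSmul_apply, map_smul, LinearMap.smul_apply, smul_eq_mul, hsymm]
  congr 1 <;> exact Finset.sum_congr rfl fun j _ => by ring

/-- Nondegeneracy transfers the properties of the form to F. For evenness, the component of F(X, Y)
of the wrong parity is B-orthogonal to all of g. -/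
theorem isEvenSuperAntisymm_of_form (hB : IsQuadraticSpace B)
    {F : V₀ × V₁ →ₗ[ℂ] V₀ × V₁ →ₗ[ℂ] V₀ × V₁} {I : SuperExt V₀ V₁}
    (hp : paritySign V₀ V₁ I = I) (hF : ∀ X Y Z, B (F X Y) Z = form V₀ V₁ I X Y Z) :
    IsEvenSuperAntisymm F where
  even x y X hX Y hY := by
    have h0 : ∀ z, ∀ Z ∈ part V₀ V₁ z, x + y + z = 1 → B (F X Y) Z = 0 := fun z Z hZ h => by
      rw [hF, form_eq_zero hp hX hY hZ h]
    rcases zmod_two_cases (x + y) with h | h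
    · have : (F X Y).2 = 0 := by
        have : ((0, (F X Y).2) : V₀ × V₁) = 0 := by
          refine hB.eq_zero fun W => ?_
          have h1 := h0 1 (0, W.2) (odd_mem_part _) (by rw [h, zero_add])
          have h2 : F X Y = ((F X Y).1, 0) + (0, (F X Y).2) := by simp
          have h3 : W = (W.1, 0) + (0, W.2) := by simp
          rw [h2, map_add, LinearMap.add_apply, hB.even_odd, zero_add] at h1
          rw [h3, map_add, hB.odd_even, zero_add]
          exact h1
        exact congrArg Prod.snd this
      have h2 : F X Y = ((F X Y).1, 0) := Prod.ext rfl this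
      rw [h, h2]
      exact even_mem_part _
    · have : (F X Y).1 = 0 := by
        have : (((F X Y).1, 0) : V₀ × V₁) = 0 := by
          refine hB.eq_zero fun W => ?_
          have h1 := h0 0 (W.1, 0) (even_mem_part _) (by rw [h, add_zero])
          have h2 : F X Y = ((F X Y).1, 0) + (0, (F X Y).2) := by simp
          have h3 : W = (W.1, 0) + (0, W.2) := by simp
          rw [h2, map_add, LinearMap.add_apply, hB.odd_even, add_zero] at h1
          rw [h3, map_add, hB.even_odd, add_zero]
          exact h1
        exact congrArg Prod.fst this
      have h2 : F X Y = (0, (F X Y).2) := Prod.ext this rfl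
      rw [h, h2]
      exact odd_mem_part _
  antisymm x y X hX Y hY := by
    refine sub_eq_zero.mp (hB.eq_zero fun W => ?_)
    rw [map_sub, LinearMap.sub_apply, map_smul, LinearMap.smul_apply, hF, hF,
      form_swap_left I hX hY, smul_eq_mul, sub_self]

/-- Invariance is the cyclic symmetry of the form read through the supersymmetry of B; the two
parity automorphisms cancel. -/
theorem isInvariant_of_form (hB : IsQuadraticSpace B)
    {F : V₀ × V₁ →ₗ[ℂ] V₀ × V₁ →ₗ[ℂ] V₀ × V₁} {I : SuperExt V₀ V₁}
    (hp : paritySign V₀ V₁ I = I) (hF : ∀ X Y Z, B (F X Y) Z = form V₀ V₁ I X Y Z) :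
    IsInvariant B F := by
  intro X Y Z
  rw [← hB.parity_symm (F Y Z) X, hF, hF, ← form_cyclic hp Y Z (parityMap X), parityMap_parityMap]

end Bracket

/-! ### The master equation {I, I} = 0 and the Jacobi identity. -/

section Jacobi

variable {V₀ V₁ : Type*} [AddCommGroup V₀] [Module ℂ V₀] [AddCommGroup V₁] [Module ℂ V₁]
variable {B : LinearMap.BilinForm ℂ (V₀ × V₁)}

theorem contr_poisson_of_mem (b : AdaptedBasis B) {x y : ZMod 2} {X : V₀ × V₁}
    (hX : X ∈ part V₀ V₁ x) {n : ℕ} {A A' : SuperExt V₀ V₁} (hA : A ∈ degree V₀ V₁ n)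
    (hA' : paritySign V₀ V₁ A' = sgn 1 y • A') :
    contr V₀ V₁ X (poisson b A A') = sgn x y • poisson b (contr V₀ V₁ X A) A' +
      (-1 : ℂ) ^ n • poisson b A (contr V₀ V₁ X A') := by
  rw [contr_poisson b hX A hA', totalSign_of_mem_degree hA, map_smul, LinearMap.smul_apply]

theorem paritySign_contr_of_eq {x y : ZMod 2} {X : V₀ × V₁} (hX : X ∈ part V₀ V₁ x)
    {A : SuperExt V₀ V₁} (hA : paritySign V₀ V₁ A = sgn 1 y • A) :
    paritySign V₀ V₁ (contr V₀ V₁ X A) = sgn 1 (y + x) • contr V₀ V₁ X A := by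
  rw [paritySign_contr hX, hA, map_smul, smul_smul, sgn_add_right, mul_comm]

set_option maxHeartbeats 1000000 in
/-- The fourfold contraction of `{I, I}`. -/
theorem contr_contr_contr_contr_poisson (b : AdaptedBasis B) {I : SuperExt V₀ V₁}
    (hI : I ∈ degree V₀ V₁ 3) (hp : paritySign V₀ V₁ I = I) {x y z t : ZMod 2}
    {X Y Z T : V₀ × V₁} (hX : X ∈ part V₀ V₁ x) (hY : Y ∈ part V₀ V₁ y)
    (hZ : Z ∈ part V₀ V₁ z) (hT : T ∈ part V₀ V₁ t) :
    ∀ c, c = contr V₀ V₁ → c T (c Z (c Y (c X (poisson b I I)))) =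
      poisson b (c Y (c X I)) (c T (c Z I)) - sgn z y • poisson b (c Z (c X I)) (c T (c Y I)) +
      sgn t (y + z) • poisson b (c T (c X I)) (c Z (c Y I)) +
      (sgn y x * sgn z x) • poisson b (c Z (c Y I)) (c T (c X I)) -
      (sgn y x * sgn t (x + z)) • poisson b (c T (c Y I)) (c Z (c X I)) +
      (sgn z (x + y) * sgn t (x + y)) • poisson b (c T (c Z I)) (c Y (c X I)) := by
  intro c hc
  have leib : ∀ {w u : ZMod 2} {W : V₀ × V₁}, W ∈ part V₀ V₁ w → ∀ {n : ℕ}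
      {A A' : SuperExt V₀ V₁}, A ∈ degree V₀ V₁ n → paritySign V₀ V₁ A' = sgn 1 u • A' →
      c W (poisson b A A') = sgn w u • poisson b (c W A) A' +
        (-1 : ℂ) ^ n • poisson b A (c W A') := by
    subst hc
    exact fun hW _ _ _ hA hA' => contr_poisson_of_mem b hW hA hA'
  have par : ∀ {w u : ZMod 2} {W : V₀ × V₁}, W ∈ part V₀ V₁ w → ∀ {A : SuperExt V₀ V₁},
      paritySign V₀ V₁ A = sgn 1 u • A → paritySign V₀ V₁ (c W A) = sgn 1 (u + w) • c W A := by
    subst hc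
    exact fun hW _ hA => paritySign_contr_of_eq hW hA
  have mem : ∀ W {n : ℕ} {A : SuperExt V₀ V₁}, A ∈ degree V₀ V₁ (n + 1) →
      c W A ∈ degree V₀ V₁ n := by
    subst hc
    exact fun W _ _ hA => contr_mem W hA
  -- From here on, c is known only through the Leibniz rule, its effect on parity and its effect on
  -- degree.
  clear hc
  have hp0 : paritySign V₀ V₁ I = sgn 1 0 • I := by rw [hp, sgn_zero_right, one_smul]
  have p1 : ∀ {w : ZMod 2} {W : V₀ × V₁}, W ∈ part V₀ V₁ w →
      paritySign V₀ V₁ (c W I) = sgn 1 w • c W I := fun {w W} hW => by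
    have := par hW hp0
    rwa [zero_add] at this
  have d1 : ∀ W, c W I ∈ degree V₀ V₁ 2 := fun W => mem W hI
  have d2 : ∀ W W', c W (c W' I) ∈ degree V₀ V₁ 1 := fun W W' => mem W (d1 W')
  have d3 : ∀ W W' W'', c W (c W' (c W'' I)) ∈ degree V₀ V₁ 0 :=
    fun W W' W'' => mem W (d2 W' W'')
  -- Each of the four contractions can fall on either copy of I. As constants have zero bracket with
  -- everything, only the six splittings 2 + 2 survive.
  have z1 : ∀ W W' W'' A, poisson b (c W (c W' (c W'' I))) A = 0 :=
    fun W W' W'' A => poisson_of_mem_zero_left b (d3 W W' W'') A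
  have z2 : ∀ W W' W'' A, poisson b A (c W (c W' (c W'' I))) = 0 :=
    fun W W' W'' A => poisson_of_mem_zero_right b A (d3 W W' W'')
  have pXY := par hY (p1 hX)
  have pXZ := par hZ (p1 hX)
  have pYZ := par hZ (p1 hY)
  have e1 : c X (poisson b I I) = poisson b (c X I) I - poisson b I (c X I) := by
    rw [leib hX hI hp0, sgn_zero_right]
    norm_num [sub_eq_add_neg]
  have e2 : c Y (c X (poisson b I I)) = poisson b (c Y (c X I)) I + poisson b (c X I) (c Y I) -
      sgn y x • poisson b (c Y I) (c X I) + poisson b I (c Y (c X I)) := by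
    rw [e1, map_sub, leib hY (d1 X) hp0, leib hY hI (p1 hX),
      sgn_zero_right]
    norm_num
    abel
  have e3 : c Z (c Y (c X (poisson b I I))) = -poisson b (c Y (c X I)) (c Z I) +
      sgn z y • poisson b (c Z (c X I)) (c Y I) + poisson b (c X I) (c Z (c Y I)) -
      (sgn y x * sgn z x) • poisson b (c Z (c Y I)) (c X I) -
      sgn y x • poisson b (c Y I) (c Z (c X I)) +
      sgn z (x + y) • poisson b (c Z I) (c Y (c X I)) := by
    have h1 := leib hZ (d2 Y X) hp0
    have h2 := leib hZ (d1 X) (p1 hY)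
    have h3 := leib hZ (d1 Y) (p1 hX)
    have h4 := leib hZ hI pXY
    rw [z1 Z Y X, smul_zero, zero_add, pow_one, neg_one_smul] at h1
    rw [z2 Z Y X, smul_zero, add_zero] at h4
    rw [neg_one_sq, one_smul] at h2 h3
    rw [e2, LinearMap.map_add, LinearMap.map_sub, LinearMap.map_add, LinearMap.map_smul, h1, h2,
      h3, h4, smul_add, smul_smul]
    abel
  have h1 := leib hT (d2 Y X) (p1 hZ)
  have h2 := leib hT (d2 Z X) (p1 hY)
  have h3 := leib hT (d1 X) pYZ
  have h4 := leib hT (d2 Z Y) (p1 hX)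
  have h5 := leib hT (d1 Y) pXZ
  have h6 := leib hT (d1 Z) pXY
  rw [z1 T Y X, smul_zero, zero_add, pow_one, neg_one_smul] at h1
  rw [z1 T Z X, smul_zero, zero_add, pow_one, neg_one_smul] at h2
  rw [z1 T Z Y, smul_zero, zero_add, pow_one, neg_one_smul] at h4
  rw [z2 T Z Y, smul_zero, add_zero] at h3
  rw [z2 T Z X, smul_zero, add_zero] at h5
  rw [z2 T Y X, smul_zero, add_zero] at h6
  rw [e3]
  simp only [LinearMap.map_add, LinearMap.map_neg, LinearMap.map_smul, h1, h2,
    h3, h4, h5, h6, smul_neg, neg_neg, smul_smul, sub_eq_add_neg]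

/-- The values of `{I, I}` in terms of the associated bracket. -/
theorem eval_poisson_self (hB : IsQuadraticSpace B) (b : AdaptedBasis B) {I : SuperExt V₀ V₁}
    (hI : I ∈ degree V₀ V₁ 3) (hp : paritySign V₀ V₁ I = I)
    {F : V₀ × V₁ →ₗ[ℂ] V₀ × V₁ →ₗ[ℂ] V₀ × V₁}
    (hF : ∀ X Y Z, B (F X Y) Z = form V₀ V₁ I X Y Z) {x y z t : ZMod 2}
    {X Y Z T : V₀ × V₁} (hX : X ∈ part V₀ V₁ x) (hY : Y ∈ part V₀ V₁ y)
    (hZ : Z ∈ part V₀ V₁ z) (hT : T ∈ part V₀ V₁ t) :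
    eval 4 ![X, Y, Z, T] (poisson b I I) = 2 * (B (F X Y) (F Z T) -
      sgn y z * B (F X Z) (F Y T) + sgn x (y + z) * B (F Y Z) (F X T)) := by
  have hev := (isEvenSuperAntisymm_of_form hB hp hF).even
  -- The double contraction of I by W and W' is the linear form B(F(W, W'), ·).
  have hpois : ∀ W W' U U', poisson b (contr V₀ V₁ W' (contr V₀ V₁ W I))
      (contr V₀ V₁ U' (contr V₀ V₁ U I)) = B (F W W') (F U U') • 1 := fun W W' U U' =>
    poisson_of_mem_one hB b (contr_mem _ (contr_mem _ hI)) (contr_mem _ (contr_mem _ hI))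
      (fun S => (hF W W' S).symm) (fun S => (hF U U' S).symm)
  change scalarPart V₀ V₁ (contr V₀ V₁ T (contr V₀ V₁ Z (contr V₀ V₁ Y (contr V₀ V₁ X
    (poisson b I I))))) = _
  rw [contr_contr_contr_contr_poisson b hI hp hX hY hZ hT _ rfl]
  simp only [hpois, map_add, map_sub, map_smul, scalarPart_one, smul_eq_mul, mul_one]
  -- Supersymmetry of B matches the splittings XY|ZT and ZT|XY, and likewise the other two pairs;
  -- this is the factor 2. The signs are compared for all sixteen parities.
  rw [hB.supersymm _ _ _ (hev x t X hX T hT) _ (hev y z Y hY Z hZ),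
    hB.supersymm _ _ _ (hev y t Y hY T hT) _ (hev x z X hX Z hZ),
    hB.supersymm _ _ _ (hev z t Z hZ T hT) _ (hev x y X hX Y hY)]
  have h2 : (1 : ZMod 2) + 1 = 0 := rfl
  rcases zmod_two_cases x with rfl | rfl <;> rcases zmod_two_cases y with rfl | rfl <;>
    rcases zmod_two_cases z with rfl | rfl <;> rcases zmod_two_cases t with rfl | rfl <;>
    simp only [sgn_zero_left, sgn_zero_right, sgn_one_one, h2, add_zero, zero_add] <;> ring

/-- The Jacobi identity paired with a vector. -/
theorem jacobi_pairing {F : V₀ × V₁ →ₗ[ℂ] V₀ × V₁ →ₗ[ℂ] V₀ × V₁} (hF : IsEvenSuperAntisymm F)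
    (hinv : IsInvariant B F) {x y z : ZMod 2} {X Y Z : V₀ × V₁} (hX : X ∈ part V₀ V₁ x)
    (hY : Y ∈ part V₀ V₁ y) (hZ : Z ∈ part V₀ V₁ z) (T : V₀ × V₁) :
    B (F (F X Y) Z + sgn x y • F Y (F X Z) - F X (F Y Z)) T =
      B (F X Y) (F Z T) - sgn y z * B (F X Z) (F Y T) + sgn x (y + z) * B (F Y Z) (F X T) := by
  -- Antisymmetry puts the inner bracket in the first slot; invariance then moves the outer bracket
  -- onto T.
  rw [hF.antisymm _ _ X hX _ (hF.even y z Y hY Z hZ),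
    hF.antisymm _ _ Y hY _ (hF.even x z X hX Z hZ)]
  simp only [map_add, map_sub, map_smul, LinearMap.add_apply, LinearMap.sub_apply,
    LinearMap.smul_apply, smul_eq_mul, hinv _ _ T, sgn_add_right y x z, sgn_comm y x]
  linear_combination -(sgn y z * B (F X Z) (F Y T)) * sgn_mul_self x y

/-- The values of {I, I} are twice the Jacobi expression paired with T. One direction uses that a
form of degree 4 is determined by its values, the other the nondegeneracy of B. -/
theorem isLieSuper_iff [FiniteDimensional ℂ V₀] [FiniteDimensional ℂ V₁]
    (hB : IsQuadraticSpace B) (b : AdaptedBasis B) {I : SuperExt V₀ V₁}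
    (hI : I ∈ degree V₀ V₁ 3) (hp : paritySign V₀ V₁ I = I)
    {F : V₀ × V₁ →ₗ[ℂ] V₀ × V₁ →ₗ[ℂ] V₀ × V₁}
    (hF : ∀ X Y Z, B (F X Y) Z = form V₀ V₁ I X Y Z) :
    IsLieSuper F ↔ poisson b I I = 0 := by
  have hanti := isEvenSuperAntisymm_of_form hB hp hF
  have hinv := isInvariant_of_form hB hp hF
  constructor
  · intro hL
    refine eq_zero_of_eval_eq_zero 4 (poisson_mem (n := 2) (m := 2) b hI hI) fun v hv => ?_
    obtain ⟨x, hx⟩ := hv 0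
    obtain ⟨y, hy⟩ := hv 1
    obtain ⟨z, hz⟩ := hv 2
    obtain ⟨t, ht⟩ := hv 3
    have hv : v = ![v 0, v 1, v 2, v 3] := by
      funext i; fin_cases i <;> rfl
    rw [hv, eval_poisson_self hB b hI hp hF hx hy hz ht, ← jacobi_pairing hanti hinv hx hy hz,
      ← hL.jacobi x y _ hx _ hy, sub_self, map_zero, LinearMap.zero_apply, mul_zero]
  · intro h
    refine { hanti with jacobi := fun x y X hX Y hY Z => ?_ }
    suffices key : F X ∘ₗ F Y = F (F X Y) + sgn x y • (F Y ∘ₗ F X) from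
      congrArg (fun L : V₀ × V₁ →ₗ[ℂ] V₀ × V₁ => L Z) key
    refine linearMap_ext_part fun z Z hZ => ?_
    refine (sub_eq_zero.mp (hB.eq_zero fun T => ?_)).symm
    suffices key : B (F (F X Y) Z + sgn x y • F Y (F X Z) - F X (F Y Z)) = 0 from
      congrArg (fun L : V₀ × V₁ →ₗ[ℂ] ℂ => L T) key
    refine linearMap_ext_part fun t T hT => ?_
    have := eval_poisson_self hB b hI hp hF hX hY hZ hT
    rw [h, map_zero, ← jacobi_pairing hanti hinv hX hY hZ] at this
    simpa using this.symm

end Jacobi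

/-! ### Realising super-antisymmetric trilinear forms in E^{(3,0)}. -/

section Existence

variable {V₀ V₁ : Type*} [AddCommGroup V₀] [Module ℂ V₀] [AddCommGroup V₁] [Module ℂ V₁]
variable {B : LinearMap.BilinForm ℂ (V₀ × V₁)}

/-- An even super-antisymmetric trilinear form on `g`. -/
structure IsSuperAlternating (T : V₀ × V₁ →ₗ[ℂ] V₀ × V₁ →ₗ[ℂ] V₀ × V₁ →ₗ[ℂ] ℂ) : Prop where
  swap_left : ∀ x y : ZMod 2, ∀ X ∈ part V₀ V₁ x, ∀ Y ∈ part V₀ V₁ y, ∀ Z,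
    T X Y Z = -sgn x y * T Y X Z
  swap_right : ∀ y z : ZMod 2, ∀ X, ∀ Y ∈ part V₀ V₁ y, ∀ Z ∈ part V₀ V₁ z,
    T X Y Z = -sgn y z * T X Z Y
  even : ∀ x y z : ZMod 2, ∀ X ∈ part V₀ V₁ x, ∀ Y ∈ part V₀ V₁ y, ∀ Z ∈ part V₀ V₁ z,
    x + y + z = 1 → T X Y Z = 0

theorem isSuperAlternating_form {I : SuperExt V₀ V₁} (hp : paritySign V₀ V₁ I = I) :
    IsSuperAlternating (form V₀ V₁ I) where
  swap_left _ _ _ hX _ hY Z := form_swap_left I hX hY Z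
  swap_right _ _ X _ hY _ hZ := form_swap_right I X hY hZ
  even _ _ _ _ hX _ hY _ hZ h := form_eq_zero hp hX hY hZ h

/-- Invariance rewrites B(F(X, Y), Z) as B(X, F(Y, Z)), so antisymmetry of F also governs the last
two arguments. -/
theorem isSuperAlternating_of_invariant (hB : IsQuadraticSpace B)
    {F : V₀ × V₁ →ₗ[ℂ] V₀ × V₁ →ₗ[ℂ] V₀ × V₁} (hF : IsEvenSuperAntisymm F)
    (hinv : IsInvariant B F) : IsSuperAlternating (F.compr₂ B) where
  swap_left x y X hX Y hY Z := by
    rw [LinearMap.compr₂_apply, LinearMap.compr₂_apply, hF.antisymm x y X hX Y hY, map_smul,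
      LinearMap.smul_apply, smul_eq_mul]
  swap_right y z X Y hY Z hZ := by
    rw [LinearMap.compr₂_apply, LinearMap.compr₂_apply, hinv, hinv, hF.antisymm y z Y hY Z hZ,
      map_smul, smul_eq_mul]
  even x y z X hX Y hY Z hZ h := by
    have hXY := hF.even x y X hX Y hY
    rw [LinearMap.compr₂_apply]
    rcases zmod_two_cases (x + y) with h' | h' <;> rw [h'] at h hXY
    · rw [zero_add] at h
      subst h
      exact hB.even _ hXY _ hZ
    · rw [add_eq_left] at h
      subst h
      rw [hB.supersymm 1 0 _ hXY _ hZ, hB.even _ hZ _ hXY, mul_zero]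

/-- An even super-antisymmetric trilinear form is determined by its restrictions to `g₀ × g₀ × g₀`
and `g₀ × g₁ × g₁`. -/
theorem IsSuperAlternating.ext {T T' : V₀ × V₁ →ₗ[ℂ] V₀ × V₁ →ₗ[ℂ] V₀ × V₁ →ₗ[ℂ] ℂ}
    (hT : IsSuperAlternating T) (hT' : IsSuperAlternating T')
    (h0 : ∀ X Y Z : V₀, T (X, 0) (Y, 0) (Z, 0) = T' (X, 0) (Y, 0) (Z, 0))
    (h1 : ∀ (X : V₀) (Y Z : V₁), T (X, 0) (0, Y) (0, Z) = T' (X, 0) (0, Y) (0, Z)) : T = T' := by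
  have hodd : ∀ x y z : ZMod 2, ∀ X ∈ part V₀ V₁ x, ∀ Y ∈ part V₀ V₁ y, ∀ Z ∈ part V₀ V₁ z,
      x + y + z = 1 → T X Y Z = T' X Y Z := fun x y z X hX Y hY Z hZ h => by
    rw [hT.even x y z X hX Y hY Z hZ h, hT'.even x y z X hX Y hY Z hZ h]
  have e := even_mem_part (V₀ := V₀) (V₁ := V₁)
  have o := odd_mem_part (V₀ := V₀) (V₁ := V₁)
  have h2 : ∀ (X : V₁) (Y : V₀) (Z : V₁),
      T (0, X) (Y, 0) (0, Z) = T' (0, X) (Y, 0) (0, Z) := fun X Y Z => by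
    rw [hT.swap_left 1 0 _ (o X) _ (e Y), hT'.swap_left 1 0 _ (o X) _ (e Y), h1]
  -- Of the eight parity patterns four have odd sum, where both forms vanish; transpositions reduce
  -- the other four to the two given ones.
  refine LinearMap.prod_ext (LinearMap.ext fun X => ?_) (LinearMap.ext fun X => ?_) <;>
    refine LinearMap.prod_ext (LinearMap.ext fun Y => ?_) (LinearMap.ext fun Y => ?_) <;>
    refine LinearMap.prod_ext (LinearMap.ext fun Z => ?_) (LinearMap.ext fun Z => ?_)
  · exact h0 X Y Z
  · exact hodd 0 0 1 _ (e X) _ (e Y) _ (o Z) rfl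
  · exact hodd 0 1 0 _ (e X) _ (o Y) _ (e Z) rfl
  · exact h1 X Y Z
  · exact hodd 1 0 0 _ (o X) _ (e Y) _ (e Z) rfl
  · exact h2 X Y Z
  · change T (0, X) (0, Y) (Z, 0) = T' (0, X) (0, Y) (Z, 0)
    rw [hT.swap_right 1 0 _ _ (o Y) _ (e Z), hT'.swap_right 1 0 _ _ (o Y) _ (e Z), h2]
  · exact hodd 1 1 1 _ (o X) _ (o Y) _ (o Z) rfl

/-- The expansion of a trilinear form in bases. -/
theorem sum_trilinear {V M N P κ κ' κ'' : Type*} [AddCommGroup V] [Module ℂ V]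
    [AddCommGroup M] [Module ℂ M] [AddCommGroup N] [Module ℂ N] [AddCommGroup P] [Module ℂ P]
    [Fintype κ] [Fintype κ'] [Fintype κ'']
    (T : V →ₗ[ℂ] V →ₗ[ℂ] V →ₗ[ℂ] ℂ) (i : M →ₗ[ℂ] V) (i' : N →ₗ[ℂ] V) (i'' : P →ₗ[ℂ] V)
    (e : Module.Basis κ ℂ M) (e' : Module.Basis κ' ℂ N) (e'' : Module.Basis κ'' ℂ P)
    (X : M) (Y : N) (Z : P) :
    ∑ j, ∑ k, ∑ l, T (i (e j)) (i' (e' k)) (i'' (e'' l)) *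
      (e.coord j X * e'.coord k Y * e''.coord l Z) = T (i X) (i' Y) (i'' Z) := by
  have h1 : ∀ C D, T (i X) C D = ∑ j, e.coord j X * T (i (e j)) C D := fun C D => by
    conv_lhs => rw [← e.sum_repr X]
    simp only [map_sum, map_smul, LinearMap.sum_apply, LinearMap.smul_apply, smul_eq_mul,
      Module.Basis.coord_apply]
  have h2 : ∀ C D, T C (i' Y) D = ∑ k, e'.coord k Y * T C (i' (e' k)) D := fun C D => by
    conv_lhs => rw [← e'.sum_repr Y]
    simp only [map_sum, map_smul, LinearMap.sum_apply, LinearMap.smul_apply, smul_eq_mul,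
      Module.Basis.coord_apply]
  have h3 : ∀ C D, T C D (i'' Z) = ∑ l, e''.coord l Z * T C D (i'' (e'' l)) := fun C D => by
    conv_lhs => rw [← e''.sum_repr Z]
    simp only [map_sum, map_smul, smul_eq_mul, Module.Basis.coord_apply]
  rw [h1]
  refine Finset.sum_congr rfl fun j _ => ?_
  rw [h2, Finset.mul_sum]
  refine Finset.sum_congr rfl fun k _ => ?_
  rw [h3, Finset.mul_sum, Finset.mul_sum]
  exact Finset.sum_congr rfl fun l _ => by ring

theorem form_alt_even (α β γ : Module.Dual ℂ V₀) (X Y Z : V₀) :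
    form V₀ V₁ (ofTensor V₀ V₁ ((ExteriorAlgebra.ι ℂ α * (ExteriorAlgebra.ι ℂ β *
      ExteriorAlgebra.ι ℂ γ)) ⊗ₜ[ℂ] 1)) (X, 0) (Y, 0) (Z, 0) =
    α X * β Y * γ Z - α X * β Z * γ Y - α Y * β X * γ Z + α Z * β X * γ Y +
      α Y * β Z * γ X - α Z * β Y * γ X := by
  rw [form_apply, contr_even, contr_even, contr_even, evenInterior_tmul, evenInterior_tmul,
    evenInterior_tmul, scalarPart_tmul]
  simp only [altInterior_ι_mul, altInterior_ι, map_sub, map_smul, Algebra.algebraMap_eq_smul_one,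
    mul_smul_comm, mul_one, map_one, smul_sub, smul_smul, smul_eq_mul, altInterior_one,
    smul_zero, sub_zero, mul_zero]
  ring

theorem form_alt_odd (Ω : Alt V₀) (X : V₀) (Y Z : V₁) :
    form V₀ V₁ (ofTensor V₀ V₁ (Ω ⊗ₜ[ℂ] 1)) (X, 0) (0, Y) (0, Z) = 0 := by
  rw [form_apply, contr_even, contr_odd Y, evenInterior_tmul, totalSign_tmul, symSign_one,
    oddDeriv_tmul, Derivation.map_one_eq_zero, TensorProduct.tmul_zero, map_zero, neg_zero,
    map_zero, map_zero]

theorem form_mixed_even (α : Module.Dual ℂ V₀) (G : Sym V₁) (X Y Z : V₀) :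
    form V₀ V₁ (ofTensor V₀ V₁ (ExteriorAlgebra.ι ℂ α ⊗ₜ[ℂ] G)) (X, 0) (Y, 0) (Z, 0) = 0 := by
  rw [form_apply, contr_even, contr_even, contr_even, evenInterior_tmul, evenInterior_tmul,
    altInterior_ι, altInterior_algebraMap, TensorProduct.zero_tmul, map_zero, map_zero, map_zero]

/-- The minus sign comes from the conventions: an odd contraction is -∂ in degree 2 and +∂ in degree
1. -/
theorem form_mixed_odd (α : Module.Dual ℂ V₀) (p q : Module.Dual ℂ V₁) (X : V₀) (Y Z : V₁) :
    form V₀ V₁ (ofTensor V₀ V₁ (ExteriorAlgebra.ι ℂ α ⊗ₜ[ℂ]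
      (SymmetricAlgebra.ι ℂ _ p * SymmetricAlgebra.ι ℂ _ q))) (X, 0) (0, Y) (0, Z) =
      -(α X * p Y * q Z + α X * p Z * q Y) := by
  simp only [form_apply, contr_even, contr_odd, evenInterior_tmul, totalSign_tmul, oddDeriv_tmul,
    map_neg, neg_neg, scalarPart_tmul, altInterior_ι, altSign_algebraMap, symSign_mul, symSign_ι,
    Derivation.leibniz, symDeriv_ι, smul_eq_mul, map_add, symSign_algebraMap,
    Derivation.map_algebraMap, mul_zero, map_zero, mul_neg, neg_mul, map_mul,
    ExteriorAlgebra.algebraMap_leftInverse _ _, SymmetricAlgebra.algebraMap_leftInverse _ _]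
  ring

theorem ι_mem_altPow (α : Module.Dual ℂ V₀) : ExteriorAlgebra.ι ℂ α ∈ altPow V₀ 1 := by
  change _ ∈ LinearMap.range (ExteriorAlgebra.ι ℂ) ^ 1
  rw [pow_one]
  exact LinearMap.mem_range_self _ _

/-- Every even super-antisymmetric trilinear form comes from `E^{(3,0)}(g)`. -/
theorem exists_form_eq [FiniteDimensional ℂ V₀] [FiniteDimensional ℂ V₁]
    {T : V₀ × V₁ →ₗ[ℂ] V₀ × V₁ →ₗ[ℂ] V₀ × V₁ →ₗ[ℂ] ℂ} (hT : IsSuperAlternating T) :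
    ∃ I ∈ bidegree V₀ V₁ 3 0, form V₀ V₁ I = T := by
  let e := Module.finBasis ℂ V₀
  let e' := Module.finBasis ℂ V₁
  let i := LinearMap.inl ℂ V₀ V₁
  let i' := LinearMap.inr ℂ V₀ V₁
  let J : SuperExt V₀ V₁ := ∑ j, ∑ k, ∑ l, T (i (e j)) (i (e k)) (i (e l)) •
    ofTensor V₀ V₁ ((ExteriorAlgebra.ι ℂ (e.coord j) * (ExteriorAlgebra.ι ℂ (e.coord k) *
      ExteriorAlgebra.ι ℂ (e.coord l))) ⊗ₜ[ℂ] 1)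
  let K : SuperExt V₀ V₁ := ∑ j, ∑ k, ∑ l, T (i (e j)) (i' (e' k)) (i' (e' l)) •
    ofTensor V₀ V₁ (ExteriorAlgebra.ι ℂ (e.coord j) ⊗ₜ[ℂ]
      (SymmetricAlgebra.ι ℂ _ (e'.coord k) * SymmetricAlgebra.ι ℂ _ (e'.coord l)))
  have hJ : J ∈ bidegree V₀ V₁ 3 0 := by
    refine sum_mem fun j _ => sum_mem fun k _ => sum_mem fun l _ => Submodule.smul_mem _ _ ?_
    exact tensorPart_le_bidegree (ω := 3) (f := 0) rfl rfl (tmul_mem_tensorPart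
      (SetLike.mul_mem_graded (ι_mem_altPow _)
        (SetLike.mul_mem_graded (ι_mem_altPow _) (ι_mem_altPow _)))
      SetLike.GradedOne.one_mem)
  have hK : K ∈ bidegree V₀ V₁ 3 0 := by
    refine sum_mem fun j _ => sum_mem fun k _ => sum_mem fun l _ => Submodule.smul_mem _ _ ?_
    exact tensorPart_le_bidegree (ω := 1) (f := 2) rfl rfl (tmul_mem_tensorPart
      (ι_mem_altPow _) (SetLike.mul_mem_graded (ι_mem_symPow V₁ _) (ι_mem_symPow V₁ _)))
  -- J takes the values 6T on even triples, K the values -2T on g₀ × g₁ × g₁, and each vanishes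
  -- where the other is needed.
  have hI : (6 : ℂ)⁻¹ • J - (2 : ℂ)⁻¹ • K ∈ bidegree V₀ V₁ 3 0 :=
    sub_mem (Submodule.smul_mem _ _ hJ) (Submodule.smul_mem _ _ hK)
  have hp := paritySign_of_mem_bidegree hI
  rw [sgn_zero_right, one_smul] at hp
  refine ⟨_, hI, (isSuperAlternating_form hp).ext hT (fun X Y Z => ?_) (fun X Y Z => ?_)⟩
  · have hswap : ∀ X Y Z : V₀, T (i X) (i Y) (i Z) = -T (i Y) (i X) (i Z) := fun X Y Z => by
      have := hT.swap_left 0 0 _ (even_mem_part X) _ (even_mem_part Y) (i Z)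
      rwa [sgn_zero_left, neg_one_mul] at this
    have hswap' : ∀ X Y Z : V₀, T (i X) (i Y) (i Z) = -T (i X) (i Z) (i Y) := fun X Y Z => by
      have := hT.swap_right 0 0 (i X) _ (even_mem_part Y) _ (even_mem_part Z)
      rwa [sgn_zero_left, neg_one_mul] at this
    have hK0 : form V₀ V₁ K (X, 0) (Y, 0) (Z, 0) = 0 := by
      simp only [K, map_sum, map_smul, LinearMap.sum_apply, LinearMap.smul_apply, form_mixed_even,
        smul_zero, Finset.sum_const_zero]
    have hJ0 : form V₀ V₁ J (X, 0) (Y, 0) (Z, 0) = 6 * T (i X) (i Y) (i Z) := by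
      have hsum := sum_trilinear T i i i e e e
      have : form V₀ V₁ J (X, 0) (Y, 0) (Z, 0) = T (i X) (i Y) (i Z) - T (i X) (i Z) (i Y) -
          T (i Y) (i X) (i Z) + T (i Z) (i X) (i Y) + T (i Y) (i Z) (i X) -
          T (i Z) (i Y) (i X) := by
        -- Each of the six permuted values is expanded in coordinates, so that the equality holds
        -- term by term by `form_alt_even`.
        rw [← hsum X Y Z, ← hsum X Z Y, ← hsum Y X Z, ← hsum Z X Y, ← hsum Y Z X, ← hsum Z Y X]
        simp only [J, map_sum, map_smul, LinearMap.sum_apply, LinearMap.smul_apply, form_alt_even,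
          smul_eq_mul, ← Finset.sum_sub_distrib, ← Finset.sum_add_distrib]
        refine (Finset.sum_congr rfl fun j _ => Finset.sum_congr rfl fun k _ =>
          Finset.sum_congr rfl fun l _ => ?_)
        ring
      rw [this, hswap' X Z Y, hswap Y X Z, hswap Z X Y, hswap' X Z Y, hswap' Y Z X, hswap Y X Z,
        hswap' Z Y X, hswap Z X Y, hswap' X Z Y]
      ring
    rw [map_sub, map_smul, map_smul]
    simp only [LinearMap.sub_apply, LinearMap.smul_apply, smul_eq_mul, hK0, hJ0]
    change _ = T (i X) (i Y) (i Z)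
    ring
  · have hswap : T (i X) (i' Z) (i' Y) = T (i X) (i' Y) (i' Z) := by
      have := hT.swap_right 1 1 (i X) _ (odd_mem_part Z) _ (odd_mem_part Y)
      rwa [sgn_one_one, neg_neg, one_mul] at this
    have hJ0 : form V₀ V₁ J (X, 0) (0, Y) (0, Z) = 0 := by
      simp only [J, map_sum, map_smul, LinearMap.sum_apply, LinearMap.smul_apply, form_alt_odd,
        smul_zero, Finset.sum_const_zero]
    have hK0 : form V₀ V₁ K (X, 0) (0, Y) (0, Z) = -(2 * T (i X) (i' Y) (i' Z)) := by
      have hsum := sum_trilinear T i i' i' e e' e'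
      rw [two_mul]
      nth_rewrite 2 [← hswap]
      rw [← hsum X Z Y, ← hsum X Y Z]
      simp only [K, map_sum, map_smul, LinearMap.sum_apply, LinearMap.smul_apply, form_mixed_odd,
        smul_eq_mul, ← Finset.sum_neg_distrib, ← Finset.sum_add_distrib]
      refine (Finset.sum_congr rfl fun j _ => Finset.sum_congr rfl fun k _ =>
        Finset.sum_congr rfl fun l _ => ?_)
      ring
    rw [map_sub, map_smul, map_smul]
    simp only [LinearMap.sub_apply, LinearMap.smul_apply, smul_eq_mul, hK0, hJ0]
    change _ = T (i X) (i' Y) (i' Z)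
    ring

end Existence

/-! ### Existence of orthonormal and Darboux bases. -/

section Bases

/-- A nondegenerate symmetric bilinear form over `ℂ` has an orthonormal basis. -/
theorem exists_orthonormal_basis {V : Type*} [AddCommGroup V] [Module ℂ V]
    [FiniteDimensional ℂ V] (B : LinearMap.BilinForm ℂ V) (hs : LinearMap.IsSymm B)
    (hn : ∀ x, (∀ y, B x y = 0) → x = 0) :
    ∃ e : Module.Basis (Fin (Module.finrank ℂ V)) ℂ V,
      ∀ i j, B (e i) (e j) = if i = j then 1 else 0 := by
  obtain ⟨v, hv⟩ := LinearMap.BilinForm.exists_orthogonal_basis hs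
  have hv' : ∀ i j, i ≠ j → B (v i) (v j) = 0 := fun i j hij => hv hij
  -- An isotropic member of an orthogonal basis would be orthogonal to everything.
  have hne : ∀ i, B (v i) (v i) ≠ 0 := by
    intro i hi
    refine v.ne_zero i (hn _ fun y => ?_)
    suffices h : B (v i) = 0 by rw [h, LinearMap.zero_apply]
    refine v.ext fun j => ?_
    rcases eq_or_ne i j with rfl | hij
    · simpa using hi
    · simpa using hv' i j hij
  -- Square roots exist in ℂ; dividing by them normalises the basis.
  have hsq : ∀ i, ∃ c : ℂ, c ^ 2 = B (v i) (v i) := fun i =>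
    IsAlgClosed.exists_pow_nat_eq _ two_pos
  choose c hc using hsq
  have hc0 : ∀ i, c i ≠ 0 := fun i h => hne i (by rw [← hc i, h]; simp)
  refine ⟨v.unitsSMul fun i => (Units.mk0 (c i) (hc0 i))⁻¹, fun i j => ?_⟩
  have happ : ∀ i, v.unitsSMul (fun i => (Units.mk0 (c i) (hc0 i))⁻¹) i = (c i)⁻¹ • v i :=
    fun i => by simp [Module.Basis.unitsSMul_apply, Units.smul_def]
  rw [happ, happ, map_smul, map_smul, LinearMap.smul_apply, smul_eq_mul, smul_eq_mul]
  split_ifs with hij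
  · subst hij
    rw [← hc i]
    have := hc0 i
    field_simp
  · rw [hv' i j hij, mul_zero, mul_zero]

/-- Two families of vectors which satisfy the Darboux relations. -/
structure IsDarboux {V : Type*} [AddCommGroup V] [Module ℂ V] (B : LinearMap.BilinForm ℂ V)
    {n : ℕ} (p q : Fin n → V) : Prop where
  left : ∀ i j, B (p i) (p j) = 0
  right : ∀ i j, B (q i) (q j) = 0
  pairing : ∀ i j, B (p i) (q j) = if i = j then 1 else 0

variable {V : Type*} [AddCommGroup V] [Module ℂ V] {B : LinearMap.BilinForm ℂ V}

/-- Pairing a relation with qⱼ or pⱼ isolates a single coefficient. -/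
theorem IsDarboux.linearIndependent {n : ℕ} {p q : Fin n → V} (h : IsDarboux B p q) :
    LinearIndependent ℂ (Sum.elim p q) := by
  rw [Fintype.linearIndependent_iff]
  intro g hg
  simp only [Fintype.sum_sum_type, Sum.elim_inl, Sum.elim_inr] at hg
  rintro (j | j)
  · have := congrArg (fun x => B x (q j)) hg
    simpa [LinearMap.sum_apply, h.pairing, h.right] using this
  · have := congrArg (fun x => B (p j) x) hg
    simpa [h.pairing, h.left] using this

/-- Every vector is orthogonal to a Darboux family up to an element of its span. -/
theorem IsDarboux.exists_sub_orthogonal (hB : ∀ x y, B x y = -B y x) {n : ℕ} {p q : Fin n → V}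
    (h : IsDarboux B p q) (x : V) :
    ∃ s ∈ Submodule.span ℂ (Set.range (Sum.elim p q)),
      (∀ j, B (x - s) (p j) = 0) ∧ ∀ j, B (x - s) (q j) = 0 := by
  refine ⟨∑ i, (B x (q i) • p i - B x (p i) • q i), ?_, fun j => ?_, fun j => ?_⟩
  · refine sum_mem fun i _ => sub_mem ?_ ?_ <;> refine Submodule.smul_mem _ _ ?_
    · exact Submodule.subset_span ⟨.inl i, rfl⟩
    · exact Submodule.subset_span ⟨.inr i, rfl⟩
  · simp [LinearMap.sum_apply, h.left, hB (q _) (p j), h.pairing]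
  · simp [LinearMap.sum_apply, h.right, h.pairing]

/-- A vector outside the span is made orthogonal to the family, giving u ≠ 0. A partner y with B(u,
y) = 1 exists by nondegeneracy and scaling; subtracting its part in the span makes it orthogonal to
the family as well. -/
theorem IsDarboux.exists_extension (hB : ∀ x y, B x y = -B y x)
    (hn : ∀ x, (∀ y, B x y = 0) → x = 0) {n : ℕ} {p q : Fin n → V} (h : IsDarboux B p q)
    (hspan : ¬ ⊤ ≤ Submodule.span ℂ (Set.range (Sum.elim p q))) :
    ∃ p' q' : Fin (n + 1) → V, IsDarboux B p' q' := by
  obtain ⟨x, -, hx⟩ := SetLike.not_le_iff_exists.mp hspan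
  obtain ⟨s, hs, hsp, hsq⟩ := h.exists_sub_orthogonal hB x
  have hne : x - s ≠ 0 := fun h0 => hx (by rwa [sub_eq_zero.mp h0])
  obtain ⟨y, hy⟩ : ∃ y, B (x - s) y ≠ 0 := by
    by_contra! hy
    exact hne (hn _ hy)
  obtain ⟨r, hr, hrp, hrq⟩ := h.exists_sub_orthogonal hB ((B (x - s) y)⁻¹ • y)
  generalize x - s = u at *
  -- Since u is orthogonal to the span, correcting the partner by r does not change its pairing with
  -- u.
  have hur : B u r = 0 := by
    have : Submodule.span ℂ (Set.range (Sum.elim p q)) ≤ LinearMap.ker (B u) := by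
      rw [Submodule.span_le]
      rintro _ ⟨i | i, rfl⟩
      · exact hsp i
      · exact hsq i
    exact this hr
  have huw : B u ((B u y)⁻¹ • y - r) = 1 := by
    rw [map_sub, hur, map_smul, smul_eq_mul, inv_mul_cancel₀ hy, sub_zero]
  generalize (B u y)⁻¹ • y - r = w at *
  have hself : ∀ z, B z z = 0 := fun z => self_eq_neg.mp (hB z z)
  refine ⟨Fin.cons u p, Fin.cons w q, ?_, ?_, ?_⟩ <;>
    refine Fin.cases (Fin.cases ?_ fun j => ?_) fun i => Fin.cases ?_ fun j => ?_
  · exact hself u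
  · exact hsp j
  · simpa [hB (p i)] using hsp i
  · exact h.left i j
  · exact hself w
  · exact hrq j
  · simpa [hB (q i)] using hrq i
  · exact h.right i j
  · simpa using huw
  · simpa [Fin.succ_ne_zero, (Fin.succ_ne_zero _).symm] using hsq j
  · simpa [Fin.succ_ne_zero, hB (p i)] using hrp i
  · simpa using h.pairing i j

/-- A nondegenerate alternating bilinear form has a Darboux basis. -/
theorem exists_darboux_basis [FiniteDimensional ℂ V] (hB : ∀ x y, B x y = -B y x)
    (hn : ∀ x, (∀ y, B x y = 0) → x = 0) :
    ∃ (n : ℕ) (e : Module.Basis (Fin n ⊕ Fin n) ℂ V), IsDarboux B (e ∘ .inl) (e ∘ .inr) := by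
  -- If no Darboux family spanned, extension would never stop, and linear independence would exceed
  -- the dimension.
  by_contra hcon
  have key : ∀ n : ℕ, ∃ p q : Fin n → V, IsDarboux B p q := by
    intro n
    induction n with
    | zero => exact ⟨Fin.elim0, Fin.elim0, fun i => i.elim0, fun i => i.elim0, fun i => i.elim0⟩
    | succ n ih =>
      obtain ⟨p, q, h⟩ := ih
      refine h.exists_extension hB hn fun hspan => hcon
        ⟨n, Module.Basis.mk h.linearIndependent hspan, ?_⟩
      rw [Module.Basis.coe_mk]
      exact h
  obtain ⟨p, q, h⟩ := key (Module.finrank ℂ V + 1)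
  have := h.linearIndependent.fintype_card_le_finrank
  simp at this
  omega

variable {V₀ V₁ : Type*} [AddCommGroup V₀] [Module ℂ V₀] [FiniteDimensional ℂ V₀]
  [AddCommGroup V₁] [Module ℂ V₁] [FiniteDimensional ℂ V₁]

/-- As B is even, its restrictions to g₀ and g₁ are both nondegenerate; they are symmetric and
antisymmetric respectively. -/
theorem IsQuadraticSpace.nonempty_adaptedBasis {B : LinearMap.BilinForm ℂ (V₀ × V₁)}
    (hB : IsQuadraticSpace B) : Nonempty (AdaptedBasis B) := by
  let B₀ : LinearMap.BilinForm ℂ V₀ :=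
    B.compl₁₂ (LinearMap.inl ℂ V₀ V₁) (LinearMap.inl ℂ V₀ V₁)
  let B₁ : LinearMap.BilinForm ℂ V₁ :=
    B.compl₁₂ (LinearMap.inr ℂ V₀ V₁) (LinearMap.inr ℂ V₀ V₁)
  obtain ⟨e, he⟩ := exists_orthonormal_basis B₀ ⟨fun X Y => hB.even_symm X Y⟩ fun X hX => by
    have : ((X, 0) : V₀ × V₁) = 0 := hB.eq_zero fun W => by
      have hW : W = (W.1, 0) + (0, W.2) := by simp
      rw [hW, map_add, hB.even_odd, add_zero]
      exact hX W.1
    exact congrArg Prod.fst this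
  obtain ⟨n, e', he'⟩ := exists_darboux_basis (B := B₁) (fun X Y => hB.odd_symm X Y) fun Y hY => by
    have : ((0, Y) : V₀ × V₁) = 0 := hB.eq_zero fun W => by
      have hW : W = (W.1, 0) + (0, W.2) := by simp
      rw [hW, map_add, hB.odd_even, zero_add]
      exact hY W.2
    exact congrArg Prod.snd this
  exact ⟨⟨_, n, e, e', he, he'.left, he'.right, he'.pairing⟩⟩

end Bases

end QuadSuper

end

/-! ### The main theorem. -/

open QuadSuper in
theorem mainTheorem9 {V₀ V₁ : Type*} [AddCommGroup V₀] [Module ℂ V₀] [FiniteDimensional ℂ V₀]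
    [AddCommGroup V₁] [Module ℂ V₁] [FiniteDimensional ℂ V₁]
    (B : LinearMap.BilinForm ℂ (V₀ × V₁)) (hB : IsQuadraticSpace B) :
    Nonempty (AdaptedBasis B) ∧
    ∀ b : AdaptedBasis B,
      (bidegree V₀ V₁ 3 0 = tensorPart V₀ V₁ 3 0 ⊔ tensorPart V₀ V₁ 1 2 ∧
        Disjoint (tensorPart V₀ V₁ 3 0) (tensorPart V₀ V₁ 1 2)) ∧
      (∀ F : V₀ × V₁ →ₗ[ℂ] V₀ × V₁ →ₗ[ℂ] V₀ × V₁, IsQuadraticLieSuper B F →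
        ∃ I ∈ bidegree V₀ V₁ 3 0,
          IsAssociated B F I ∧
          (∀ J ∈ degree V₀ V₁ 3, IsAssociated B F J → J = I) ∧
          (∀ d, IsDifferential F d ↔ d = -poisson b I) ∧
          poisson b I I = 0) ∧
      (∀ I ∈ bidegree V₀ V₁ 3 0,
        ∃ F : V₀ × V₁ →ₗ[ℂ] V₀ × V₁ →ₗ[ℂ] V₀ × V₁,
          IsEvenSuperAntisymm F ∧
          (∀ G, IsDifferential G (-poisson b I) ↔ G = F) ∧
          (IsLieSuper F ↔ poisson b I I = 0) ∧
          (poisson b I I = 0 → IsAssociated B F I ∧ IsInvariant B F)) ∧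
      ∃ Φ : {F : V₀ × V₁ →ₗ[ℂ] V₀ × V₁ →ₗ[ℂ] V₀ × V₁ // IsQuadraticLieSuper B F} ≃
          {I : SuperExt V₀ V₁ // I ∈ bidegree V₀ V₁ 3 0 ∧ poisson b I I = 0},
        ∀ F, IsAssociated B F.1 (Φ F).1 ∧ IsDifferential F.1 (-poisson b (Φ F).1) := by
  refine ⟨hB.nonempty_adaptedBasis, fun b => ?_⟩
  have hpar : ∀ I ∈ bidegree V₀ V₁ 3 0, paritySign V₀ V₁ I = I := fun I hI => by
    have := paritySign_of_mem_bidegree hI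
    rwa [sgn_zero_right, one_smul] at this
  have hdeg : ∀ I ∈ bidegree V₀ V₁ 3 0, I ∈ degree V₀ V₁ 3 := fun I hI =>
    bidegree_le_degree 3 0 hI
  have huniq : ∀ F : V₀ × V₁ →ₗ[ℂ] V₀ × V₁ →ₗ[ℂ] V₀ × V₁, ∀ I ∈ degree V₀ V₁ 3,
      ∀ J ∈ degree V₀ V₁ 3, IsAssociated B F I → IsAssociated B F J → J = I := by
    intro F I hI J hJ hFI hFJ
    refine eq_of_eval_eq hJ hI fun v => ?_
    have hv : v = ![v 0, v 1, v 2] := by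
      funext i; fin_cases i <;> rfl
    rw [hv, hFI, hFJ]
  -- A bracket with associated form I must be the one built from I, by nondegeneracy; so (A) reduces
  -- to the results on `bracketOf`.
  have hbracket : ∀ F : V₀ × V₁ →ₗ[ℂ] V₀ × V₁ →ₗ[ℂ] V₀ × V₁, ∀ I ∈ bidegree V₀ V₁ 3 0,
      IsAssociated B F I → F = bracketOf b I := by
    intro F I hI hF
    refine LinearMap.ext₂ fun X Y => sub_eq_zero.mp (hB.eq_zero fun Z => ?_)
    rw [map_sub, LinearMap.sub_apply, bracketOf_spec hB b (hpar I hI), ← hF, eval_eq_form, sub_self]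
  have hA : ∀ F : V₀ × V₁ →ₗ[ℂ] V₀ × V₁ →ₗ[ℂ] V₀ × V₁, IsQuadraticLieSuper B F →
      ∃ I ∈ bidegree V₀ V₁ 3 0, IsAssociated B F I ∧ IsDifferential F (-poisson b I) ∧
        poisson b I I = 0 := by
    intro F hF
    obtain ⟨I, hI, hform⟩ := exists_form_eq
      (isSuperAlternating_of_invariant hB hF.1.toIsEvenSuperAntisymm hF.2)
    have hass : IsAssociated B F I := fun X Y Z => by
      rw [eval_eq_form, hform, LinearMap.compr₂_apply]
    refine ⟨I, hI, hass, ?_, ?_⟩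
    · rw [hbracket F I hI hass]
      exact isDifferential_bracketOf b (hdeg I hI) (hpar I hI)
    · exact (isLieSuper_iff hB b (hdeg I hI) (hpar I hI) fun X Y Z => (hass X Y Z).symm).mp hF.1
  refine ⟨⟨bidegree_three_zero, disjoint_tensorPart (by norm_num) 0 2⟩, ?_, ?_, ?_⟩
  · intro F hF
    obtain ⟨I, hI, hass, hd, h0⟩ := hA F hF
    refine ⟨I, hI, hass, fun J hJ hJF => huniq F I (hdeg I hI) J hJ hass hJF, fun d => ?_, h0⟩
    exact ⟨fun h => h.unique_operator hd, fun h => h ▸ hd⟩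
  · intro I hI
    have hspec := bracketOf_spec hB b (hpar I hI)
    have hd := isDifferential_bracketOf b (hdeg I hI) (hpar I hI)
    refine ⟨bracketOf b I, isEvenSuperAntisymm_of_form hB (hpar I hI) hspec,
      fun G => ⟨fun h => h.unique_bracket hd, fun h => h ▸ hd⟩,
      isLieSuper_iff hB b (hdeg I hI) (hpar I hI) hspec, fun _ => ⟨fun X Y Z => ?_,
      isInvariant_of_form hB (hpar I hI) hspec⟩⟩
    rw [hspec, eval_eq_form]
  -- The inverse of F ↦ I is `bracketOf`. One composite is the identity by `hbracket`, the other
  -- because a cubic form is determined by its values.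
  · choose I hI hass hd h0 using hA
    refine ⟨⟨fun F => ⟨I F.1 F.2, hI F.1 F.2, h0 F.1 F.2⟩, fun J => ⟨bracketOf b J.1,
      (isLieSuper_iff hB b (hdeg _ J.2.1) (hpar _ J.2.1)
        (bracketOf_spec hB b (hpar _ J.2.1))).mpr J.2.2,
      isInvariant_of_form hB (hpar _ J.2.1) (bracketOf_spec hB b (hpar _ J.2.1))⟩, ?_, ?_⟩, ?_⟩
    · intro F
      exact Subtype.ext (hbracket F.1 _ (hI F.1 F.2) (hass F.1 F.2)).symm
    · intro J
      refine Subtype.ext (huniq (bracketOf b J.1) _ (hdeg _ J.2.1) _ (hdeg _ (hI _ _)) ?_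
        (hass _ _))
      intro X Y Z
      rw [bracketOf_spec hB b (hpar _ J.2.1), eval_eq_form]
    · exact fun F => ⟨hass F.1 F.2, hd F.1 F.2⟩
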